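/- Let $X=\mathbb{CP}^1$, let $U=\{[1:z]\}\subset X$ with coordinate $\xi([1:z])=z$, and let $p_1,\dots,p_n\in U$ be distinct points. Let $E=\mathcal O\oplus\mathcal O$ with its standard trivialization $\psi_E$ over $U$. A Hecke modification $E\xleftarrow{\alpha}F$ at $p$ is a morphism $\alpha:F\to E$ of rank 2 holomorphic vector bundles on $X$ that is an isomorphism on the fibers over all $q\neq p$ and that near $p$, in suitable holomorphic local trivializations and a local coordinate $\zeta$, has the matrix $\mathrm{diag}(1,\zeta-\zeta(p))$. Let $\mathcal H^{tot}(X,E;p_1,\dots,p_n)$ be the set of sequences $E\xleftarrow{\alpha_1}E_1\xleftarrow{\alpha_2}\cdots\xleftarrow{\alpha_n}E_n$ of Hecke modifications at $p_1,\dots,p_n$ modulo isomorphisms $E_i\cong E_i'$ that commute with all the maps $\alpha_i,\alpha_i'$ and with $\mathrm{id}_E$. The Hecke length of $\mathcal O(a)\oplus\mathcal O(b)$ is $|a-b|$, and $\mathcal H(S^2,n)=\mathcal H(X;p_1,\dots,p_n)\subset\mathcal H^{tot}(X,E;p_1,\dots,p_n)$ is the set of classes whose terminal bundle $E_n$ (with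 $E_0=E$) has the minimum possible Hecke length, which is $0$ for even $n$ and $1$ for odd $n$. For $A\in GL_2(\mathbb C[[z]])$ let $\eta([A\,\mathrm{diag}(1,z)])=[a:c]\in\mathbb{CP}^1$, where $(a,c)$ is the first column of $A(0)$ and $[\cdot]$ is the class in the affine Grassmannian $GL_2(\mathbb C((z)))/GL_2(\mathbb C[[z]])$. Let $h=(h_1,\dots,h_n):\mathcal H^{tot}(X,E;p_1,\dots,p_n)\to(\mathbb{CP}^1)^n$, where $h_i$ is $\eta$ of the class of the expansion at $\xi(p_i)$ of the matrix of $\alpha_1\circ\cdots\circ\alpha_i$ with respect to $\psi_E$ and a holomorphic trivialization of $E_i$ near $p_i$. Then for $n\in\{0,1,2,3\}$ the map $h$ is well-defined and bijective, $n \bmod 2$ is indeed the minimum Hecke length of $E_n$ over all such sequences, and $h$ restricts to bijections $$\mathcal H(S^2,0)\cong\{pt\},\qquad \mathcal H(S^2,1)\cong\mathbb{CP}^1,$$ $$\mathcal H(S^2,2)\cong(\mathbb{CP}^1)^2\setminus\{(a,a)\mid a\in\mathbb{CP}^1\},\qquad \mathcal H(S^2,3)\cong(\mathbb{CP}^1)^3\setminus\{(a,a,a)\mid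 a\in\mathbb{CP}^1\}.$$ -/

import Mathlib

open scoped Manifold ContDiff Bundle Topology LinearAlgebra.Projectivization PowerSeries
open Bundle Set

noncomputable section

/-! ### The projective line as a complex manifold -/

/-- The complex projective line. -/
abbrev CP1 : Type := ℙ ℂ (Fin 2 → ℂ)

namespace CP1

/-- The quotient topology. -/
instance : TopologicalSpace CP1 :=
  inferInstanceAs (TopologicalSpace (Quotient (projectivizationSetoid ℂ (Fin 2 → ℂ))))

/-- The open set of points whose `i`-th homogeneous coordinate does not vanish. -/
def U (i : Fin 2) : Set CP1 :=
  {x | Projectivization.lift (fun v : {v : Fin 2 → ℂ // v ≠ 0} => v.1 i ≠ 0)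
    (by
      rintro ⟨a, ha⟩ ⟨b, hb⟩ t h
      dsimp only at h ⊢
      have ht : t ≠ 0 := by rintro rfl; exact ha (by simpa using h)
      simp [h, ht]) x}

/-- The affine coordinates: `ξ 0 [x : y] = y / x` on `U 0` and `ξ 1 [x : y] = x / y` on `U 1`. -/
def ξ (i : Fin 2) (x : CP1) : ℂ :=
  Projectivization.lift (fun v : {v : Fin 2 → ℂ // v ≠ 0} => v.1 (1 - i) / v.1 i)
    (by
      rintro ⟨a, ha⟩ ⟨b, hb⟩ t h
      dsimp only at h ⊢
      have ht : t ≠ 0 := by rintro rfl; exact ha (by simpa using h)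
      simp [h, mul_div_mul_left _ _ ht]) x

/-- The vector `(1, z)` for `i = 0` and `(z, 1)` for `i = 1`. -/
def vec (i : Fin 2) (z : ℂ) : Fin 2 → ℂ := fun j => if j = i then 1 else z

theorem vec_self (i : Fin 2) (z : ℂ) : vec i z i = 1 := by simp [vec]

theorem vec_other (i : Fin 2) (z : ℂ) : vec i z (1 - i) = z := by
  fin_cases i <;> simp [vec]

theorem vec_ne_zero (i : Fin 2) (z : ℂ) : vec i z ≠ 0 := fun h => by
  have := congrFun h i
  simp [vec] at this

/-- The inverse of the coordinate `ξ i`: `z ↦ [1 : z]` for `i = 0` and `z ↦ [z : 1]` for `i = 1`. -/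
def pt (i : Fin 2) (z : ℂ) : CP1 := Projectivization.mk ℂ (vec i z) (vec_ne_zero i z)

theorem mk_mem_U (i : Fin 2) (v : Fin 2 → ℂ) (hv : v ≠ 0) :
    Projectivization.mk ℂ v hv ∈ U i ↔ v i ≠ 0 := Iff.rfl

theorem ξ_mk (i : Fin 2) (v : Fin 2 → ℂ) (hv : v ≠ 0) :
    ξ i (Projectivization.mk ℂ v hv) = v (1 - i) / v i := rfl

theorem pt_mem_U (i : Fin 2) (z : ℂ) : pt i z ∈ U i := by
  rw [pt, mk_mem_U, vec_self]; exact one_ne_zero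

theorem ξ_pt (i : Fin 2) (z : ℂ) : ξ i (pt i z) = z := by
  rw [pt, ξ_mk, vec_self, vec_other, div_one]

theorem pt_ξ (i : Fin 2) (x : CP1) (hx : x ∈ U i) : pt i (ξ i x) = x := by
  induction x using Projectivization.ind with
  | h v hv =>
    rw [mk_mem_U] at hx
    rw [ξ_mk, pt, Projectivization.mk_eq_mk_iff']
    refine ⟨(v i)⁻¹, ?_⟩
    ext j
    by_cases hj : j = i
    · subst hj; simp [vec, hx]
    · have : j = 1 - i := by fin_cases i <;> fin_cases j <;> simp_all
      subst this
      simp [vec_other, div_eq_inv_mul]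

theorem isOpen_U (i : Fin 2) : IsOpen (U i) := by
  have h : IsOpen {v : {v : Fin 2 → ℂ // v ≠ 0} | v.1 i ≠ 0} :=
    isOpen_ne.preimage ((continuous_apply i).comp continuous_subtype_val)
  exact (isQuotientMap_quotient_mk' (s := projectivizationSetoid ℂ (Fin 2 → ℂ))).isOpen_preimage.1 h

theorem continuousOn_ξ (i : Fin 2) : ContinuousOn (ξ i) (U i) := by
  have hq := isQuotientMap_quotient_mk' (s := projectivizationSetoid ℂ (Fin 2 → ℂ))
  refine (hq.continuousOn_isOpen_iff (isOpen_U i)).2 ?_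
  have : ContinuousOn (fun v : {v : Fin 2 → ℂ // v ≠ 0} => v.1 (1 - i) / v.1 i)
      {v | v.1 i ≠ 0} :=
    ContinuousOn.div ((continuous_apply _).comp continuous_subtype_val).continuousOn
      ((continuous_apply _).comp continuous_subtype_val).continuousOn fun v hv => hv
  exact this

theorem continuous_pt (i : Fin 2) : Continuous (pt i) := by
  have h1 : Continuous fun z : ℂ => (⟨vec i z, vec_ne_zero i z⟩ : {v : Fin 2 → ℂ // v ≠ 0}) := by
    refine Continuous.subtype_mk (continuous_pi fun j => ?_) _
    by_cases hj : j = i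
    · simpa [vec, hj] using continuous_const
    · simp only [vec, hj, if_false]; exact continuous_id
  exact continuous_quotient_mk'.comp h1

/-- The coordinate `ξ i : U i → ℂ` as a chart. -/
def chart (i : Fin 2) : OpenPartialHomeomorph CP1 ℂ where
  toFun := ξ i
  invFun := pt i
  source := U i
  target := univ
  map_source' _ _ := mem_univ _
  map_target' z _ := pt_mem_U i z
  left_inv' x hx := pt_ξ i x hx
  right_inv' z _ := ξ_pt i z
  open_source := isOpen_U i
  open_target := isOpen_univ
  continuousOn_toFun := continuousOn_ξ i
  continuousOn_invFun := (continuous_pt i).continuousOn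

open Classical in
/-- The index of a coordinate patch that contains the given point. -/
def idx (x : CP1) : Fin 2 := if x ∈ U 0 then 0 else 1

theorem mem_U_idx (x : CP1) : x ∈ U (idx x) := by
  unfold idx
  split_ifs with h
  · exact h
  · induction x using Projectivization.ind with
    | h v hv =>
      rw [mk_mem_U] at h ⊢
      intro h1
      apply hv
      ext j
      fin_cases j
      · simpa using h
      · simpa using h1

instance : ChartedSpace ℂ CP1 where
  atlas := range chart
  chartAt x := chart (idx x)
  mem_chart_source x := mem_U_idx x
  chart_mem_atlas _ := mem_range_self _

theorem ξ_ne_zero {i j : Fin 2} (hij : i ≠ j) {x : CP1} (hi : x ∈ U i) (hj : x ∈ U j) :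
    ξ i x ≠ 0 := by
  induction x using Projectivization.ind with
  | h v hv =>
    rw [mk_mem_U] at hi hj
    have : j = 1 - i := by fin_cases i <;> fin_cases j <;> simp_all
    subst this
    rw [ξ_mk]
    exact div_ne_zero hj hi

theorem ξ_inv {i j : Fin 2} (hij : i ≠ j) (x : CP1) : ξ j x = (ξ i x)⁻¹ := by
  induction x using Projectivization.ind with
  | h v hv =>
    have : j = 1 - i := by fin_cases i <;> fin_cases j <;> simp_all
    subst this
    rw [ξ_mk, ξ_mk, inv_div]
    congr 2
    fin_cases i <;> rfl

instance : IsManifold 𝓘(ℂ, ℂ) ω CP1 := by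
  refine isManifold_of_contDiffOn _ _ _ ?_
  rintro _ _ ⟨i, rfl⟩ ⟨j, rfl⟩
  by_cases hij : i = j
  · subst hij
    refine contDiffOn_id.congr fun z _ => ?_
    exact ξ_pt i z
  · have : ContDiffOn ℂ ω (fun z : ℂ => z⁻¹) {z | z ≠ 0} := fun z hz =>
      (contDiffAt_inv ℂ hz).contDiffWithinAt
    refine (this.mono ?_).congr ?_
    · rintro z ⟨hz, -⟩
      have h2 : pt i z ∈ U j := by simpa [chart] using hz
      have := ξ_ne_zero hij (pt_mem_U i z) h2
      rwa [ξ_pt] at this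
    · intro z _
      change ξ j (pt i z) = z⁻¹
      rw [ξ_inv hij, ξ_pt]

end CP1

/-! ### Rank 2 holomorphic vector bundles on the projective line -/

/-- A rank 2 holomorphic vector bundle on the projective line. -/
structure RankTwoBundle where
  fiber : CP1 → Type
  [addCommGroup : ∀ x, AddCommGroup (fiber x)]
  [module : ∀ x, Module ℂ (fiber x)]
  [topFiber : ∀ x, TopologicalSpace (fiber x)]
  [topTotal : TopologicalSpace (TotalSpace (Fin 2 → ℂ) fiber)]
  [fiberBundle : FiberBundle (Fin 2 → ℂ) fiber]
  [vectorBundle : VectorBundle ℂ (Fin 2 → ℂ) fiber]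
  [holomorphic : ContMDiffVectorBundle ω (Fin 2 → ℂ) fiber 𝓘(ℂ, ℂ)]

namespace RankTwoBundle

attribute [instance] addCommGroup module topFiber topTotal fiberBundle vectorBundle holomorphic

/-- The total space. -/
abbrev Total (E : RankTwoBundle) : Type := TotalSpace (Fin 2 → ℂ) E.fiber

/-- A local trivialization (as a topological fiber bundle) over an open set. -/
abbrev Triv (E : RankTwoBundle) : Type :=
  Trivialization (Fin 2 → ℂ) (TotalSpace.proj : E.Total → CP1)

/-- A local trivialization is holomorphic if it is fiberwise linear and biholomorphic. -/
structure IsHolomorphicTriv {E : RankTwoBundle} (e : E.Triv) : Prop where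
  linear : e.IsLinear ℂ
  contMDiffOn : ContMDiffOn (𝓘(ℂ, ℂ).prod 𝓘(ℂ, Fin 2 → ℂ)) (𝓘(ℂ, ℂ).prod 𝓘(ℂ, Fin 2 → ℂ)) ω
    e e.source
  contMDiffOn_symm : ContMDiffOn (𝓘(ℂ, ℂ).prod 𝓘(ℂ, Fin 2 → ℂ))
    (𝓘(ℂ, ℂ).prod 𝓘(ℂ, Fin 2 → ℂ)) ω e.toOpenPartialHomeomorph.symm e.target

/-- A morphism of holomorphic vector bundles over the identity of the base. -/
@[ext]
structure Hom (E F : RankTwoBundle) where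
  toFun : ∀ x, E.fiber x →ₗ[ℂ] F.fiber x
  contMDiff : ContMDiff (𝓘(ℂ, ℂ).prod 𝓘(ℂ, Fin 2 → ℂ)) (𝓘(ℂ, ℂ).prod 𝓘(ℂ, Fin 2 → ℂ)) ω
    (fun v : E.Total => (⟨v.proj, toFun v.proj v.snd⟩ : F.Total))

/-- The identity morphism. -/
def Hom.id (E : RankTwoBundle) : Hom E E where
  toFun _ := LinearMap.id
  contMDiff := contMDiff_id

/-- The composition `g ∘ f`. -/
def Hom.comp {E F G : RankTwoBundle} (g : Hom F G) (f : Hom E F) : Hom E G where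
  toFun x := g.toFun x ∘ₗ f.toFun x
  contMDiff := g.contMDiff.comp f.contMDiff

/-- An isomorphism of holomorphic vector bundles. -/
structure Iso (E F : RankTwoBundle) where
  hom : Hom E F
  inv : Hom F E
  hom_inv : inv.comp hom = Hom.id E
  inv_hom : hom.comp inv = Hom.id F

/-- The identity isomorphism. -/
def Iso.refl (E : RankTwoBundle) : Iso E E := ⟨Hom.id E, Hom.id E, rfl, rfl⟩

/-- The inverse isomorphism. -/
def Iso.symm {E F : RankTwoBundle} (φ : Iso E F) : Iso F E :=
  ⟨φ.inv, φ.hom, φ.inv_hom, φ.hom_inv⟩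

/-- The composition of two isomorphisms. -/
def Iso.trans {E F G : RankTwoBundle} (φ : Iso E F) (χ : Iso F G) : Iso E G where
  hom := χ.hom.comp φ.hom
  inv := φ.inv.comp χ.inv
  hom_inv := by
    change φ.inv.comp ((χ.inv.comp χ.hom).comp φ.hom) = _
    rw [χ.hom_inv]; exact φ.hom_inv
  inv_hom := by
    change χ.hom.comp ((φ.hom.comp φ.inv).comp χ.inv) = _
    rw [φ.inv_hom]; exact χ.inv_hom

end RankTwoBundle

open RankTwoBundle

/-! ### The bundles `𝒪(a) ⊕ 𝒪(b)` -/

/-- The transition function of `𝒪(1)` from the trivialization over `U i` to the one over `U j`: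
`(x, v)₀ ∼ (x, ξ₁(x) v)₁`. -/
def transition (i j : Fin 2) (x : CP1) : ℂ := if i = j then 1 else CP1.ξ j x

theorem transition_ne_zero {i j : Fin 2} {x : CP1} (hi : x ∈ CP1.U i) (hj : x ∈ CP1.U j) :
    transition i j x ≠ 0 := by
  unfold transition
  split_ifs with h
  · exact one_ne_zero
  · exact CP1.ξ_ne_zero (Ne.symm h) hj hi

theorem transition_mul {i j k : Fin 2} {x : CP1} (hi : x ∈ CP1.U i) (hj : x ∈ CP1.U j) :
    transition j k x * transition i j x = transition i k x := by
  unfold transition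
  by_cases h1 : i = j
  · subst h1; simp
  · by_cases h2 : j = k
    · subst h2; simp [h1]
    · have h3 : i = k := by fin_cases i <;> fin_cases j <;> fin_cases k <;> simp_all
      subst h3
      have := CP1.ξ_ne_zero h1 hi hj
      simp [h1, Ne.symm h1, CP1.ξ_inv h1 x, this]

theorem contMDiffOn_ξ (i : Fin 2) : ContMDiffOn 𝓘(ℂ, ℂ) 𝓘(ℂ, ℂ) ω (CP1.ξ i) (CP1.U i) :=
  contMDiffOn_of_mem_maximalAtlas
    (IsManifold.subset_maximalAtlas (mem_range_self i) :
      CP1.chart i ∈ IsManifold.maximalAtlas 𝓘(ℂ, ℂ) ω CP1)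

theorem contMDiffOn_transition_zpow (i j : Fin 2) (d : ℤ) :
    ContMDiffOn 𝓘(ℂ, ℂ) 𝓘(ℂ, ℂ) ω (fun x => transition i j x ^ d) (CP1.U i ∩ CP1.U j) := by
  have h : ContMDiffOn 𝓘(ℂ, ℂ) 𝓘(ℂ, ℂ) ω (transition i j) (CP1.U i ∩ CP1.U j) := by
    by_cases hij : i = j
    · refine contMDiffOn_const (c := (1 : ℂ)) |>.congr fun x _ => ?_
      simp [transition, hij]
    · refine ((contMDiffOn_ξ j).mono inter_subset_right).congr fun x _ => ?_
      simp [transition, hij]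
  intro x hx
  have h2 : ContDiffAt ℂ ω (fun z : ℂ => z ^ d) (transition i j x) := by
    have := transition_ne_zero hx.1 hx.2
    exact (AnalyticAt.zpow analyticAt_id this).contDiffAt
  exact h2.contMDiffAt.comp_contMDiffWithinAt x (h x hx)

/-- The diagonal transition matrices of `𝒪(d 0) ⊕ 𝒪(d 1)`. -/
def splitCoordChange (d : Fin 2 → ℤ) (i j : Fin 2) (x : CP1) : (Fin 2 → ℂ) →L[ℂ] (Fin 2 → ℂ) :=
  ContinuousLinearMap.pi fun k => (transition i j x ^ d k) • ContinuousLinearMap.proj k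

theorem contMDiffOn_splitCoordChange (d : Fin 2 → ℤ) (i j : Fin 2) :
    ContMDiffOn 𝓘(ℂ, ℂ) 𝓘(ℂ, (Fin 2 → ℂ) →L[ℂ] (Fin 2 → ℂ)) ω (splitCoordChange d i j)
      (CP1.U i ∩ CP1.U j) := by
  have : splitCoordChange d i j = fun x => ∑ k : Fin 2, (transition i j x ^ d k) •
      ((ContinuousLinearMap.single ℂ (fun _ : Fin 2 => ℂ) k).comp
        (ContinuousLinearMap.proj (R := ℂ) (φ := fun _ : Fin 2 => ℂ) k)) := by
    funext x
    ext v k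
    fin_cases k <;> simp [splitCoordChange]
  rw [this]
  exact contMDiffOn_finsetSum fun k _ =>
    (contMDiffOn_transition_zpow i j (d k)).smul contMDiffOn_const

/-- The cocycle of `𝒪(d 0) ⊕ 𝒪(d 1)` with respect to the covering `U 0`, `U 1`. -/
def splitCore (d : Fin 2 → ℤ) : VectorBundleCore ℂ CP1 (Fin 2 → ℂ) (Fin 2) where
  baseSet := CP1.U
  isOpen_baseSet := CP1.isOpen_U
  indexAt := CP1.idx
  mem_baseSet_at := CP1.mem_U_idx
  coordChange := splitCoordChange d
  coordChange_self i x _ v := by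
    ext k
    simp [splitCoordChange, transition]
  continuousOn_coordChange i j := (contMDiffOn_splitCoordChange d i j).continuousOn
  coordChange_comp i j k x hx v := by
    ext l
    simp only [splitCoordChange, ContinuousLinearMap.pi_apply, _root_.smul_apply,
      ContinuousLinearMap.proj_apply, smul_eq_mul]
    rw [← transition_mul (k := k) hx.1.1 hx.1.2, mul_zpow, mul_assoc]

instance (d : Fin 2 → ℤ) : (splitCore d).IsContMDiff 𝓘(ℂ, ℂ) ω where
  contMDiffOn_coordChange := contMDiffOn_splitCoordChange d

/-- The bundle `𝒪(a) ⊕ 𝒪(b)`. -/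
def splitBundle (a b : ℤ) : RankTwoBundle where
  fiber := (splitCore ![a, b]).Fiber

/-- The standard trivialization of `𝒪(a) ⊕ 𝒪(b)` over `U 0`. -/
def standardTriv (a b : ℤ) : (splitBundle a b).Triv :=
  (splitCore ![a, b]).localTriv 0

/-- `E` has Hecke length `k`: it is isomorphic to some `𝒪(a) ⊕ 𝒪(b)` with `|a - b| = k`. -/
def HasHeckeLength (E : RankTwoBundle) (k : ℕ) : Prop :=
  ∃ a b : ℤ, Nonempty (Iso E (splitBundle a b)) ∧ |a - b| = k

/-! ### Hecke modifications -/

/-- A Hecke modification `α : F → E` of `E` at the point `p`. -/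
structure HeckeModification (E F : RankTwoBundle) (p : CP1) where
  hom : Hom F E
  bijective : ∀ q, q ≠ p → Function.Bijective (hom.toFun q)
  local_form : ∃ (ζ : OpenPartialHomeomorph CP1 ℂ) (ψE : E.Triv) (ψF : F.Triv),
    ζ ∈ IsManifold.maximalAtlas 𝓘(ℂ, ℂ) ω CP1 ∧ p ∈ ζ.source ∧
    IsHolomorphicTriv ψE ∧ ζ.source ⊆ ψE.baseSet ∧
    IsHolomorphicTriv ψF ∧ ζ.source ⊆ ψF.baseSet ∧
    ∀ q ∈ ζ.source, ∀ v : F.fiber q,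
      (ψE ⟨q, hom.toFun q v⟩).2 =
        Matrix.mulVec !![1, 0; 0, ζ q - ζ p] (ψF ⟨q, v⟩).2

/-- The family `E, B 0, …, B (n - 1)`. -/
def chain (E : RankTwoBundle) {n : ℕ} (B : Fin n → RankTwoBundle) : Fin (n + 1) → RankTwoBundle :=
  Fin.cons E B

/-- A sequence `E ← E₁ ← ⋯ ← Eₙ` of Hecke modifications of `E` at the points `p 0, …, p (n - 1)`;
here `E_{i+1}` is `bundle i`. -/
structure HeckeSequence (E : RankTwoBundle) {n : ℕ} (p : Fin n → CP1) where
  bundle : Fin n → RankTwoBundle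
  modification : ∀ i : Fin n,
    HeckeModification (chain E bundle i.castSucc) (chain E bundle i.succ) (p i)

namespace HeckeSequence

variable {E : RankTwoBundle} {n : ℕ} {p : Fin n → CP1}

/-- The terminal bundle `Eₙ` (which is `E` for `n = 0`). -/
def terminal (s : HeckeSequence E p) : RankTwoBundle := chain E s.bundle (Fin.last n)

/-- The composition `α₁ ∘ ⋯ ∘ αᵢ : Eᵢ → E`. -/
def compHom (s : HeckeSequence E p) (i : Fin (n + 1)) : Hom (chain E s.bundle i) E :=
  Fin.induction (motive := fun i => Hom (chain E s.bundle i) E) (Hom.id E)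
    (fun i f => f.comp (s.modification i).hom) i

/-- The isomorphisms `id : E → E` and `φᵢ : Eᵢ → Eᵢ'`, indexed uniformly. -/
def chainIso {B B' : Fin n → RankTwoBundle} (φ : ∀ i, Iso (B i) (B' i)) (i : Fin (n + 1)) :
    Iso (chain E B i) (chain E B' i) :=
  Fin.cases (motive := fun i => Iso (chain E B i) (chain E B' i)) (Iso.refl E) φ i

/-- Equivalence of sequences of Hecke modifications: isomorphisms `φᵢ : Eᵢ → Eᵢ'` that, together
with the identity of `E`, commute with the maps `αᵢ` and `αᵢ'`. -/
def Equivalent (s s' : HeckeSequence E p) : Prop :=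
  ∃ φ : ∀ i : Fin n, Iso (s.bundle i) (s'.bundle i), ∀ i : Fin n,
    (chainIso (E := E) φ i.castSucc).hom.comp (s.modification i).hom =
      (s'.modification i).hom.comp (chainIso (E := E) φ i.succ).hom

theorem chainIso_refl (B : Fin n → RankTwoBundle) (i : Fin (n + 1)) :
    chainIso (E := E) (fun i => Iso.refl (B i)) i = Iso.refl _ := by
  cases i using Fin.cases <;> rfl

theorem chainIso_symm {B B' : Fin n → RankTwoBundle} (φ : ∀ i, Iso (B i) (B' i))
    (i : Fin (n + 1)) :
    chainIso (E := E) (fun i => (φ i).symm) i = (chainIso (E := E) φ i).symm := by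
  cases i using Fin.cases <;> rfl

theorem chainIso_trans {B B' B'' : Fin n → RankTwoBundle} (φ : ∀ i, Iso (B i) (B' i))
    (χ : ∀ i, Iso (B' i) (B'' i)) (i : Fin (n + 1)) :
    chainIso (E := E) (fun i => (φ i).trans (χ i)) i =
      (chainIso (E := E) φ i).trans (chainIso (E := E) χ i) := by
  cases i using Fin.cases <;> rfl

theorem equivalent_equivalence : Equivalence (Equivalent (E := E) (p := p)) where
  refl s := ⟨fun i => Iso.refl _, fun i => by rw [chainIso_refl, chainIso_refl]; rfl⟩
  symm := by
    rintro s s' ⟨φ, h⟩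
    refine ⟨fun i => (φ i).symm, fun i => ?_⟩
    rw [chainIso_symm, chainIso_symm]
    have h1 := (chainIso (E := E) φ i.castSucc).hom_inv
    have h2 := (chainIso (E := E) φ i.succ).inv_hom
    calc (chainIso (E := E) φ i.castSucc).inv.comp (s'.modification i).hom
        = (chainIso (E := E) φ i.castSucc).inv.comp ((s'.modification i).hom.comp
            ((chainIso (E := E) φ i.succ).hom.comp (chainIso (E := E) φ i.succ).inv)) := by
          rw [h2]; rfl
      _ = (chainIso (E := E) φ i.castSucc).inv.comp (((s'.modification i).hom.comp
            (chainIso (E := E) φ i.succ).hom).comp (chainIso (E := E) φ i.succ).inv) := rfl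
      _ = ((chainIso (E := E) φ i.castSucc).inv.comp (chainIso (E := E) φ i.castSucc).hom).comp
            ((s.modification i).hom.comp (chainIso (E := E) φ i.succ).inv) := by
          rw [← h i]; rfl
      _ = (s.modification i).hom.comp (chainIso (E := E) φ i.succ).inv := by
          rw [h1]; rfl
  trans := by
    rintro s s' s'' ⟨φ, h⟩ ⟨χ, k⟩
    refine ⟨fun i => (φ i).trans (χ i), fun i => ?_⟩
    rw [chainIso_trans, chainIso_trans]
    calc (chainIso (E := E) χ i.castSucc).hom.comp
          ((chainIso (E := E) φ i.castSucc).hom.comp (s.modification i).hom)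
        = ((chainIso (E := E) χ i.castSucc).hom.comp (s'.modification i).hom).comp
            (chainIso (E := E) φ i.succ).hom := by rw [h i]; rfl
      _ = _ := by rw [k i]; rfl

/-- Sequences of Hecke modifications up to equivalence. -/
instance setoid (E : RankTwoBundle) {n : ℕ} (p : Fin n → CP1) : Setoid (HeckeSequence E p) :=
  ⟨Equivalent, equivalent_equivalence⟩

end HeckeSequence

/-- The space `ℋ^tot(ℂP¹, E; p₁, …, pₙ)` of equivalence classes of sequences of Hecke
modifications. -/
def HeckeTot (E : RankTwoBundle) {n : ℕ} (p : Fin n → CP1) : Type 1 :=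
  Quotient (HeckeSequence.setoid E p)

/-- The class of a sequence of Hecke modifications. -/
def HeckeSequence.toTot {E : RankTwoBundle} {n : ℕ} {p : Fin n → CP1} (s : HeckeSequence E p) :
    HeckeTot E p :=
  Quotient.mk _ s

/-- The space `ℋ(ℂP¹; p₁, …, pₙ)`: the classes of those sequences of Hecke modifications of
`𝒪 ⊕ 𝒪` whose terminal bundle has Hecke length `0` (for even `n`) or `1` (for odd `n`). -/
def HeckeSpace {n : ℕ} (p : Fin n → CP1) : Set (HeckeTot (splitBundle 0 0) p) :=
  {x | ∃ s : HeckeSequence (splitBundle 0 0) p, s.toTot = x ∧ HasHeckeLength s.terminal (n % 2)}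

/-! ### The affine Grassmannian and the map `η : Gr(1) → ℂP¹` -/

/-- The map `GL(2, ℂ[[z]]) → GL(2, ℂ((z)))`. -/
def powerToLaurent : GL (Fin 2) ℂ⟦X⟧ →* GL (Fin 2) (LaurentSeries ℂ) :=
  Matrix.GeneralLinearGroup.map (HahnSeries.ofPowerSeries ℤ ℂ)

/-- The affine Grassmannian `GL(2, ℂ((z))) / GL(2, ℂ[[z]])`. -/
abbrev AffineGrassmannian : Type := GL (Fin 2) (LaurentSeries ℂ) ⧸ powerToLaurent.range

/-- The matrix `Z = diag(1, z)`. -/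
def matZ : GL (Fin 2) (LaurentSeries ℂ) :=
  Matrix.GeneralLinearGroup.mkOfDetNeZero
    !![1, 0; 0, HahnSeries.ofPowerSeries ℤ ℂ PowerSeries.X] (by
      rw [Matrix.det_fin_two_of]
      simp)

/-- The Bruhat cell `Gr(1)`: the orbit of `[Z]` under `GL(2, ℂ[[z]])`. -/
def bruhatCell : Set AffineGrassmannian :=
  range fun A : GL (Fin 2) ℂ⟦X⟧ => ((powerToLaurent A * matZ : GL (Fin 2) (LaurentSeries ℂ)) :
    AffineGrassmannian)

/-- The first column `(a, c)` of `A(0)`. -/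
def firstColumn (A : GL (Fin 2) ℂ⟦X⟧) : Fin 2 → ℂ :=
  fun i => PowerSeries.constantCoeff ((A : Matrix (Fin 2) (Fin 2) ℂ⟦X⟧) i 0)

theorem firstColumn_ne_zero (A : GL (Fin 2) ℂ⟦X⟧) : firstColumn A ≠ 0 := by
  intro h
  have h0 : PowerSeries.constantCoeff ((A : Matrix (Fin 2) (Fin 2) ℂ⟦X⟧) 0 0) = 0 := congrFun h 0
  have h1 : PowerSeries.constantCoeff ((A : Matrix (Fin 2) (Fin 2) ℂ⟦X⟧) 1 0) = 0 := congrFun h 1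
  have hu : IsUnit (A : Matrix (Fin 2) (Fin 2) ℂ⟦X⟧).det :=
    (Matrix.isUnit_iff_isUnit_det _).1 A.isUnit
  have := hu.map (PowerSeries.constantCoeff (R := ℂ))
  rw [Matrix.det_fin_two] at this
  simp [h0, h1] at this

/-- The map `η : Gr(1) → ℂP¹`, `[A Z] ↦ [a : c]`, with `(a, c)` the first column of `A(0)`. -/
def eta (x : bruhatCell) : CP1 :=
  Projectivization.mk ℂ (firstColumn x.2.choose) (firstColumn_ne_zero _)

theorem firstColumn_eq {A B : GL (Fin 2) ℂ⟦X⟧}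
    (h : ((powerToLaurent A * matZ : GL (Fin 2) (LaurentSeries ℂ)) : AffineGrassmannian) =
      ((powerToLaurent B * matZ : GL (Fin 2) (LaurentSeries ℂ)) : AffineGrassmannian)) :
    ∃ t : ℂ, t • firstColumn A = firstColumn B := by
  rw [QuotientGroup.eq] at h
  obtain ⟨C, hC⟩ := h
  have h1 : powerToLaurent A * matZ * powerToLaurent C = powerToLaurent B * matZ := by
    rw [hC, mul_inv_cancel_left]
  refine ⟨PowerSeries.constantCoeff ((C : Matrix (Fin 2) (Fin 2) ℂ⟦X⟧) 0 0), ?_⟩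
  ext i
  have h2 := congrArg (fun M : GL (Fin 2) (LaurentSeries ℂ) =>
    (M : Matrix (Fin 2) (Fin 2) (LaurentSeries ℂ)) i 0) h1
  simp only [Units.val_mul, Matrix.mul_apply, Fin.sum_univ_two, powerToLaurent, matZ,
    Matrix.GeneralLinearGroup.map_apply] at h2
  have h3 : (A : Matrix (Fin 2) (Fin 2) ℂ⟦X⟧) i 0 * (C : Matrix (Fin 2) (Fin 2) ℂ⟦X⟧) 0 0 +
      (A : Matrix (Fin 2) (Fin 2) ℂ⟦X⟧) i 1 * PowerSeries.X *
        (C : Matrix (Fin 2) (Fin 2) ℂ⟦X⟧) 1 0 = (B : Matrix (Fin 2) (Fin 2) ℂ⟦X⟧) i 0 := by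
    apply HahnSeries.ofPowerSeries_injective (Γ := ℤ) (R := ℂ)
    simpa [Matrix.GeneralLinearGroup.mkOfDetNeZero] using h2
  have h4 := congrArg (PowerSeries.constantCoeff (R := ℂ)) h3
  simpa [firstColumn, mul_comm] using h4

/-- `η` does not depend on the choice of `A`. -/
theorem eta_mk (A : GL (Fin 2) ℂ⟦X⟧) :
    eta ⟨_, mem_range_self A⟩ = Projectivization.mk ℂ (firstColumn A) (firstColumn_ne_zero A) := by
  rw [eta, Projectivization.mk_eq_mk_iff']
  exact firstColumn_eq (mem_range_self (f := fun A : GL (Fin 2) ℂ⟦X⟧ =>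
    ((powerToLaurent A * matZ : GL (Fin 2) (LaurentSeries ℂ)) : AffineGrassmannian)) A).choose_spec.symm

/-! ### The map `h` -/

/-- The matrix `ᾱ(z)` of `α : F → E` at the point of `U 0` with coordinate `z`, with respect to
local trivializations of `E` and `F`. -/
def localMatrix {E F : RankTwoBundle} (ψE : E.Triv) (ψF : F.Triv) (α : Hom F E) (z : ℂ) :
    Matrix (Fin 2) (Fin 2) ℂ :=
  Matrix.of fun i j =>
    (ψE ⟨CP1.pt 0 z, α.toFun (CP1.pt 0 z) (ψF.symm (CP1.pt 0 z) (Pi.single j 1))⟩).2 i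

/-- The expansion of a holomorphic matrix-valued function at `μ` in powers of `z - μ`. -/
def taylorMatrix (A : ℂ → Matrix (Fin 2) (Fin 2) ℂ) (μ : ℂ) : Matrix (Fin 2) (Fin 2) ℂ⟦X⟧ :=
  Matrix.of fun i j => PowerSeries.mk fun k =>
    iteratedDeriv k (fun z => A z i j) μ / (k.factorial : ℂ)

/-- `η([A], μ) = L`: the expansion of `A` at `μ` represents a point of `Gr(1)` that `η` maps to
`L`. -/
def HasEta (A : ℂ → Matrix (Fin 2) (Fin 2) ℂ) (μ : ℂ) (L : CP1) : Prop :=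
  ∃ (g : GL (Fin 2) (LaurentSeries ℂ)) (hg : (g : AffineGrassmannian) ∈ bruhatCell),
    (g : Matrix (Fin 2) (Fin 2) (LaurentSeries ℂ)) =
      (taylorMatrix A μ).map (HahnSeries.ofPowerSeries ℤ ℂ) ∧
    eta ⟨g, hg⟩ = L

/-- `a = (a₁, …, aₙ)` is computed from the sequence `s` of Hecke modifications of `𝒪 ⊕ 𝒪` by the
rule `aᵢ = η([ᾱ₁ ⋯ ᾱᵢ], ξ(pᵢ))`, where `ᾱ₁ ⋯ ᾱᵢ` is the matrix of `α₁ ∘ ⋯ ∘ αᵢ` with respect to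
the standard trivialization of `𝒪 ⊕ 𝒪` and some holomorphic trivialization of `Eᵢ` near `pᵢ`. -/
def HasDirections {n : ℕ} {p : Fin n → CP1} (s : HeckeSequence (splitBundle 0 0) p)
    (a : Fin n → CP1) : Prop :=
  ∀ i : Fin n, ∃ ψ : (chain (splitBundle 0 0) s.bundle i.succ).Triv,
    IsHolomorphicTriv ψ ∧ p i ∈ ψ.baseSet ∧
    HasEta (localMatrix (standardTriv 0 0) ψ (s.compHom i.succ)) (CP1.ξ 0 (p i)) (a i)

/-- The map `h : ℋ^tot(ℂP¹, 𝒪 ⊕ 𝒪; p₁, …, pₙ) → (ℂP¹)ⁿ`. -/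
def heckeMap {n : ℕ} (p : Fin n → CP1) (x : HeckeTot (splitBundle 0 0) p) : Fin n → CP1 :=
  Classical.epsilon fun a => ∃ s : HeckeSequence (splitBundle 0 0) p, s.toTot = x ∧
    HasDirections s a

end

noncomputable section

open RankTwoBundle

/-! ### Holomorphic functions with values in linear maps -/

/-! The points are distinct, so `α₁ ∘ ⋯ ∘ αᵢ₋₁` is invertible at `pᵢ` and the image of `α₁ ∘ ⋯ ∘ αᵢ`
in the fiber of `𝒪 ⊕ 𝒪` at `pᵢ` is a line `Lᵢ ⊂ ℂ²`. The expansion there has the form `B diag(1, z)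
C`; at `z = 0` its range is spanned by the first column of `B(0)`, so `hᵢ` is just `Lᵢ`
(`HasEta.range_eq`, `hasDirections_iff`). The rest of the argument speaks only of these lines.

Injectivity rests on a universal property: a morphism into `E` factors through a Hecke modification
at `p` as soon as its image at `p` lies in the distinguished line, because the offending coordinate
is then divisible by `ζ - ζ(p)` (`HeckeModification.exists_lift`). Two sequences with the same lines
therefore factor through each other, and the factors are mutually inverse by continuity off finitely
many points (`equivalent_of_range_eq`).

Surjectivity is explicit: every line in a fiber of `𝒪(a) ⊕ 𝒪(b)` is the image of a triangular
modification from `𝒪(a-1) ⊕ 𝒪(b)` or `𝒪(a) ⊕ 𝒪(b-1)`, and this iterates (`exists_heckeSequence`).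
Together with injectivity it shows that every terminal bundle splits as `𝒪(c) ⊕ 𝒪(d)` with `c + d =
-n`, without Grothendieck's theorem.

By Liouville, entries of negative degree of a morphism of split bundles vanish and those of degree
zero are constant. Hence the unordered pair of degrees is an isomorphism invariant, `c, d ≤ 0`, and
a morphism `𝒪 → Eₙ`, composed into `𝒪 ⊕ 𝒪`, is a constant vector lying in every `Lᵢ`. So `c = 0` or
`d = 0` exactly when all `Lᵢ` coincide. For `n = 2, 3` the other pairs are `{-1, -1}` and `{-1,
-2}`, of minimal Hecke length; for `n ≤ 1` the length is always minimal. -/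

theorem contMDiffAt_clm_of_apply {M : CP1 → (Fin 2 → ℂ) →L[ℂ] (Fin 2 → ℂ)} {x : CP1}
    (h : ∀ v, ContMDiffAt 𝓘(ℂ, ℂ) 𝓘(ℂ, Fin 2 → ℂ) ω (fun y => M y v) x) :
    ContMDiffAt 𝓘(ℂ, ℂ) 𝓘(ℂ, (Fin 2 → ℂ) →L[ℂ] (Fin 2 → ℂ)) ω M x := by
  -- `M` is rebuilt from its columns `M y eⱼ`, each placed in `j`-th position by a fixed continuous
  -- linear map.
  have : M = fun y => ∑ j : Fin 2, ContinuousLinearMap.smulRightL ℂ (Fin 2 → ℂ) (Fin 2 → ℂ)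
      (ContinuousLinearMap.proj (R := ℂ) (φ := fun _ : Fin 2 => ℂ) j) (M y (Pi.single j 1)) := by
    funext y
    ext v k
    conv_lhs => rw [pi_eq_sum_univ' v]
    simp [Fin.sum_univ_two]
  rw [this]
  exact contMDiffAt_finsetSum fun j _ =>
    (ContinuousLinearMap.contMDiff _).contMDiffAt.comp x (h _)

theorem contMDiffAt_apply {M : CP1 → (Fin 2 → ℂ) →L[ℂ] (Fin 2 → ℂ)} {x : CP1}
    (h : ContMDiffAt 𝓘(ℂ, ℂ) 𝓘(ℂ, (Fin 2 → ℂ) →L[ℂ] (Fin 2 → ℂ)) ω M x) (v : Fin 2 → ℂ)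
    (i : Fin 2) : ContMDiffAt 𝓘(ℂ, ℂ) 𝓘(ℂ, ℂ) ω (fun y => M y v i) x :=
  ((ContinuousLinearMap.proj (R := ℂ) (φ := fun _ : Fin 2 => ℂ) i).comp
    (ContinuousLinearMap.apply ℂ (Fin 2 → ℂ) v)).contMDiff.contMDiffAt.comp x h

theorem contMDiffAt_clm_of_entries {M : CP1 → (Fin 2 → ℂ) →L[ℂ] (Fin 2 → ℂ)} {x : CP1}
    (h : ∀ v i, ContMDiffAt 𝓘(ℂ, ℂ) 𝓘(ℂ, ℂ) ω (fun y => M y v i) x) :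
    ContMDiffAt 𝓘(ℂ, ℂ) 𝓘(ℂ, (Fin 2 → ℂ) →L[ℂ] (Fin 2 → ℂ)) ω M x :=
  contMDiffAt_clm_of_apply fun v => contMDiffAt_pi_space.2 (h v)

/-- Inversion of operators is analytic at an invertible one. Invertibility at the single point `x`
suffices, although `inverse` takes the default value `0` on non-invertible operators. -/
theorem contMDiffAt_clm_inverse {M : CP1 → (Fin 2 → ℂ) →L[ℂ] (Fin 2 → ℂ)} {x : CP1}
    (h : ContMDiffAt 𝓘(ℂ, ℂ) 𝓘(ℂ, (Fin 2 → ℂ) →L[ℂ] (Fin 2 → ℂ)) ω M x)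
    (hx : (M x).IsInvertible) :
    ContMDiffAt 𝓘(ℂ, ℂ) 𝓘(ℂ, (Fin 2 → ℂ) →L[ℂ] (Fin 2 → ℂ)) ω (fun y => (M y).inverse) x := by
  obtain ⟨A, hA⟩ := hx
  have h1 : ContDiffAt ℂ ω (ContinuousLinearMap.inverse : ((Fin 2 → ℂ) →L[ℂ] (Fin 2 → ℂ)) → _)
      (M x) := hA ▸ contDiffAt_map_inverse A
  exact h1.contMDiffAt.comp x h

/-! ### Morphisms of bundles in local trivializations -/

namespace RankTwoBundle

variable {E F G : RankTwoBundle}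

/-- The matrix of a family of linear maps with respect to local trivializations. -/
def coords (f : ∀ x, E.fiber x →ₗ[ℂ] F.fiber x) (e : E.Triv) (e' : F.Triv) [e.IsLinear ℂ]
    [e'.IsLinear ℂ] (x : CP1) : (Fin 2 → ℂ) →L[ℂ] (Fin 2 → ℂ) :=
  LinearMap.toContinuousLinearMap (e'.linearMapAt ℂ x ∘ₗ f x ∘ₗ e.symmₗ ℂ x)

theorem coords_apply' (f : ∀ x, E.fiber x →ₗ[ℂ] F.fiber x) (e : E.Triv) (e' : F.Triv)
    [e.IsLinear ℂ] [e'.IsLinear ℂ] {x : CP1} (hx : x ∈ e.baseSet) (hx' : x ∈ e'.baseSet)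
    (v : Fin 2 → ℂ) :
    coords f e e' x v = (e' ⟨x, f x (e.symm x v)⟩).2 := by
  simp only [coords, LinearMap.coe_toContinuousLinearMap', LinearMap.comp_apply,
    Trivialization.coe_linearMapAt_of_mem _ hx', Trivialization.symmₗ_apply _ hx]

theorem coords_apply (f : ∀ x, E.fiber x →ₗ[ℂ] F.fiber x) (e : E.Triv) (e' : F.Triv)
    [e.IsLinear ℂ] [e'.IsLinear ℂ] {x : CP1} (hx : x ∈ e.baseSet) (hx' : x ∈ e'.baseSet)
    (v : E.fiber x) : coords f e e' x (e ⟨x, v⟩).2 = (e' ⟨x, f x v⟩).2 := by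
  rw [coords_apply' _ _ _ hx hx', Trivialization.symm_proj_apply e ⟨x, v⟩ hx]

/-- For fixed `v` the column `y ↦ e' (f (e⁻¹ (y, v)))` is a composite of holomorphic maps. -/
theorem contMDiffAt_coords (f : Hom E F) {e : E.Triv} {e' : F.Triv} [e.IsLinear ℂ]
    [e'.IsLinear ℂ] (he : IsHolomorphicTriv e) (he' : IsHolomorphicTriv e') {x : CP1}
    (hx : x ∈ e.baseSet) (hx' : x ∈ e'.baseSet) :
    ContMDiffAt 𝓘(ℂ, ℂ) 𝓘(ℂ, (Fin 2 → ℂ) →L[ℂ] (Fin 2 → ℂ)) ω (coords f.toFun e e') x := by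
  refine contMDiffAt_clm_of_apply fun v => ?_
  have h1 : ContMDiffAt 𝓘(ℂ, ℂ) (𝓘(ℂ, ℂ).prod 𝓘(ℂ, Fin 2 → ℂ)) ω
      (fun y : CP1 => (y, v)) x := contMDiffAt_id.prodMk contMDiffAt_const
  have h2 : ContMDiffAt (𝓘(ℂ, ℂ).prod 𝓘(ℂ, Fin 2 → ℂ)) (𝓘(ℂ, ℂ).prod 𝓘(ℂ, Fin 2 → ℂ)) ω
      e.toOpenPartialHomeomorph.symm (x, v) :=
    he.contMDiffOn_symm.contMDiffAt (e.open_target.mem_nhds (e.mem_target.2 hx))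
  have h3 := f.contMDiff (e.toOpenPartialHomeomorph.symm (x, v))
  have h4 : ContMDiffAt (𝓘(ℂ, ℂ).prod 𝓘(ℂ, Fin 2 → ℂ)) (𝓘(ℂ, ℂ).prod 𝓘(ℂ, Fin 2 → ℂ)) ω
      e' (⟨x, f.toFun x (e.symm x v)⟩ : F.Total) :=
    he'.contMDiffOn.contMDiffAt (e'.open_source.mem_nhds (e'.mem_source.2 hx'))
  have h5 := h3.comp x (h2.comp x h1)
  have h6 : (⟨x, f.toFun x (e.symm x v)⟩ : F.Total) = ((fun v : E.Total =>
      (⟨v.proj, f.toFun v.proj v.snd⟩ : F.Total)) ∘ e.toOpenPartialHomeomorph.symm ∘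
      (fun y : CP1 => (y, v))) x := by
    exact congrArg (fun v : E.Total => (⟨v.proj, f.toFun v.proj v.snd⟩ : F.Total)) (e.mk_symm hx v)
  rw [h6] at h4
  have h7 := contMDiffAt_snd.comp x (h4.comp x h5)
  refine h7.congr_of_eventuallyEq ?_
  filter_upwards [e.open_baseSet.mem_nhds hx, e'.open_baseSet.mem_nhds hx'] with y hy hy'
  rw [coords_apply' _ _ _ hy hy']
  exact congrArg (fun v : E.Total => (e' (⟨v.proj, f.toFun v.proj v.snd⟩ : F.Total)).2)
    (e.mk_symm hy v)

/-- The converse, used to build morphisms: any holomorphic matrix `M` that represents `f` near `x`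
will do, so `f` may be defined piecewise. -/
theorem contMDiffAt_of_coords (f : ∀ x, E.fiber x →ₗ[ℂ] F.fiber x) {e : E.Triv} {e' : F.Triv}
    [e.IsLinear ℂ] [e'.IsLinear ℂ] (he : IsHolomorphicTriv e) (he' : IsHolomorphicTriv e')
    {x : CP1} (hx : x ∈ e.baseSet) (hx' : x ∈ e'.baseSet)
    {M : CP1 → (Fin 2 → ℂ) →L[ℂ] (Fin 2 → ℂ)}
    (hM : ContMDiffAt 𝓘(ℂ, ℂ) 𝓘(ℂ, (Fin 2 → ℂ) →L[ℂ] (Fin 2 → ℂ)) ω M x)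
    (hfM : ∀ᶠ y in 𝓝 x, ∀ v : E.fiber y, (e' ⟨y, f y v⟩).2 = M y (e ⟨y, v⟩).2)
    (v : E.fiber x) :
    ContMDiffAt (𝓘(ℂ, ℂ).prod 𝓘(ℂ, Fin 2 → ℂ)) (𝓘(ℂ, ℂ).prod 𝓘(ℂ, Fin 2 → ℂ)) ω
      (fun v : E.Total => (⟨v.proj, f v.proj v.snd⟩ : F.Total)) ⟨x, v⟩ := by
  have h1 : ContMDiffAt (𝓘(ℂ, ℂ).prod 𝓘(ℂ, Fin 2 → ℂ)) (𝓘(ℂ, ℂ).prod 𝓘(ℂ, Fin 2 → ℂ)) ω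
      e (⟨x, v⟩ : E.Total) :=
    he.contMDiffOn.contMDiffAt (e.open_source.mem_nhds (e.mem_source.2 hx))
  have hc : e (⟨x, v⟩ : E.Total) = (x, (e ⟨x, v⟩).2) :=
    Prod.ext (e.coe_fst' hx) rfl
  have h2 : ContMDiffAt (𝓘(ℂ, ℂ).prod 𝓘(ℂ, Fin 2 → ℂ)) (𝓘(ℂ, ℂ).prod 𝓘(ℂ, Fin 2 → ℂ)) ω
      (fun y : CP1 × (Fin 2 → ℂ) => (y.1, M y.1 y.2)) (e (⟨x, v⟩ : E.Total)) := by
    rw [hc]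
    refine contMDiffAt_fst.prodMk ?_
    exact ContMDiffAt.clm_apply (hM.comp (x, (e ⟨x, v⟩).2) contMDiffAt_fst) contMDiffAt_snd
  have h3 : ContMDiffAt (𝓘(ℂ, ℂ).prod 𝓘(ℂ, Fin 2 → ℂ)) (𝓘(ℂ, ℂ).prod 𝓘(ℂ, Fin 2 → ℂ)) ω
      e'.toOpenPartialHomeomorph.symm ((fun y : CP1 × (Fin 2 → ℂ) => (y.1, M y.1 y.2))
        (e (⟨x, v⟩ : E.Total))) := by
    refine he'.contMDiffOn_symm.contMDiffAt (e'.open_target.mem_nhds (e'.mem_target.2 ?_))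
    rwa [hc]
  have h4 := h2.comp (⟨x, v⟩ : E.Total) h1
  have h5 := ContMDiffAt.comp (⟨x, v⟩ : E.Total) h3 h4
  refine h5.congr_of_eventuallyEq ?_
  have hp : Filter.Tendsto (TotalSpace.proj : E.Total → CP1) (𝓝 ⟨x, v⟩) (𝓝 x) :=
    (FiberBundle.continuous_proj (Fin 2 → ℂ) E.fiber).tendsto _
  filter_upwards [hp.eventually hfM, hp (e.open_baseSet.mem_nhds hx),
    hp (e'.open_baseSet.mem_nhds hx')] with y hy hye hye'
  obtain ⟨y, w⟩ := y
  have hcy : e (⟨y, w⟩ : E.Total) = (y, (e ⟨y, w⟩).2) :=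
    Prod.ext (e.coe_fst' hye) rfl
  simp only [Function.comp]
  rw [hcy]
  simp only
  rw [← hy w, ← e'.mk_symm hye', Trivialization.symm_apply_apply_mk e' hye']

/-- A trivialization in the atlas of the bundle is holomorphic. -/
theorem isHolomorphicTriv_of_mem_atlas (e : E.Triv) [MemTrivializationAtlas e] :
    IsHolomorphicTriv e where
  linear := inferInstance
  contMDiffOn := e.contMDiffOn
  contMDiffOn_symm := e.contMDiffOn_symm

theorem Hom.comp_apply (g : Hom F G) (f : Hom E F) (x : CP1) (v : E.fiber x) :
    (g.comp f).toFun x v = g.toFun x (f.toFun x v) := rfl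

theorem Hom.ext_apply {f g : Hom E F} (h : ∀ x v, f.toFun x v = g.toFun x v) : f = g :=
  Hom.ext (funext fun x => LinearMap.ext (h x))

/-- Finite sets are thereby closed, which lets `Hom.eq_of_finite` ignore the modification points. -/
instance : T1Space CP1 := by
  refine t1Space_iff_exists_open.2 fun x y hxy => ?_
  by_cases hy : y ∈ CP1.U (CP1.idx x)
  · refine ⟨_, (CP1.chart (CP1.idx x)).isOpen_inter_preimage
      (isOpen_compl_singleton (x := CP1.ξ (CP1.idx x) y)), ⟨CP1.mem_U_idx x, fun h => hxy ?_⟩,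
      fun h => h.2 rfl⟩
    rw [← CP1.pt_ξ _ x (CP1.mem_U_idx x), ← CP1.pt_ξ _ y hy]
    exact congrArg _ h
  · exact ⟨_, CP1.isOpen_U _, CP1.mem_U_idx x, hy⟩

instance neBot_nhdsWithin_compl_singleton (x : CP1) : (𝓝[≠] x).NeBot := by
  have hx := mem_chart_source ℂ x
  set c := chartAt ℂ x
  have h1 := (c.symm.map_nhdsWithin_eq (s := {c x}ᶜ) (c.mapsTo hx))
  rw [c.left_inv hx] at h1
  have : (𝓝[≠] (c x)).NeBot := inferInstance
  have h2 := this.map c.symm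
  rw [h1] at h2
  refine h2.mono (nhdsWithin_mono _ ?_)
  rintro _ ⟨y, ⟨hy1, hy2⟩, rfl⟩ h
  apply hy2
  rw [mem_singleton_iff] at h ⊢
  rw [← c.right_inv hy1, h]

/-- Two morphisms that agree in a punctured neighbourhood of a point agree there. -/
theorem Hom.eq_of_eventually {f g : Hom E F} {x : CP1}
    (h : ∀ᶠ y in 𝓝[≠] x, f.toFun y = g.toFun y) : f.toFun x = g.toFun x := by
  set e := trivializationAt (Fin 2 → ℂ) E.fiber x
  set e' := trivializationAt (Fin 2 → ℂ) F.fiber x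
  have hx : x ∈ e.baseSet := mem_baseSet_trivializationAt _ _ x
  have hx' : x ∈ e'.baseSet := mem_baseSet_trivializationAt _ _ x
  have he := isHolomorphicTriv_of_mem_atlas e
  have he' := isHolomorphicTriv_of_mem_atlas e'
  have hf := (contMDiffAt_coords f he he' hx hx').continuousAt
  have hg := (contMDiffAt_coords g he he' hx hx').continuousAt
  have h1 : coords f.toFun e e' x = coords g.toFun e e' x := by
    refine tendsto_nhds_unique_of_eventuallyEq (hf.tendsto.mono_left nhdsWithin_le_nhds)
      (hg.tendsto.mono_left nhdsWithin_le_nhds) (l := 𝓝[≠] x) ?_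
    filter_upwards [h] with y hy
    simp only [coords, hy]
  ext v
  have h2 := coords_apply f.toFun e e' hx hx' v
  rw [h1, coords_apply g.toFun e e' hx hx' v] at h2
  have h3 := congrArg (e'.symm x) h2
  simpa [Trivialization.symm_apply_apply_mk e' hx'] using h3.symm

/-- Each point has a punctured neighbourhood that misses `s`. This replaces the identity theorem
wherever injectivity fails only at the `pᵢ`. -/
theorem Hom.eq_of_finite {f g : Hom E F} (s : Set CP1) (hs : s.Finite)
    (h : ∀ x ∉ s, f.toFun x = g.toFun x) : f = g := by
  refine Hom.ext (funext fun x => Hom.eq_of_eventually ?_)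
  have : (s \ {x})ᶜ ∈ 𝓝 x := (hs.subset sdiff_subset).isClosed.isOpen_compl.mem_nhds (by simp)
  filter_upwards [nhdsWithin_le_nhds this, self_mem_nhdsWithin] with y hy hyx
  exact h y fun hys => hy ⟨hys, hyx⟩

end RankTwoBundle

/-! ### Inverting morphisms and dividing by a local coordinate. -/

namespace RankTwoBundle

variable {E F G : RankTwoBundle}

theorem triv_injective (e : E.Triv) {x : CP1} (hx : x ∈ e.baseSet) {v w : E.fiber x}
    (h : (e ⟨x, v⟩).2 = (e ⟨x, w⟩).2) : v = w := by
  have h1 := congrArg (e.symm x) h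
  rwa [Trivialization.symm_proj_apply e ⟨x, v⟩ hx, Trivialization.symm_proj_apply e ⟨x, w⟩ hx]
    at h1

theorem triv_symm (e : E.Triv) {x : CP1} (hx : x ∈ e.baseSet) (v : Fin 2 → ℂ) :
    (e ⟨x, e.symm x v⟩).2 = v := by
  rw [Trivialization.apply_mk_symm e hx]

theorem isInvertible_coords (f : ∀ x, E.fiber x →ₗ[ℂ] F.fiber x) (e : E.Triv) (e' : F.Triv)
    [e.IsLinear ℂ] [e'.IsLinear ℂ] {x : CP1} (hx : x ∈ e.baseSet) (hx' : x ∈ e'.baseSet)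
    (hf : Function.Injective (f x)) : (coords f e e' x).IsInvertible := by
  have hi : Function.Injective (coords f e e' x) := by
    intro v w h
    rw [coords_apply' _ _ _ hx hx', coords_apply' _ _ _ hx hx'] at h
    have h1 := congrArg (fun u => (e ⟨x, u⟩).2) (hf (triv_injective e' hx' h))
    simpa only [triv_symm e hx] using h1
  exact ⟨(LinearEquiv.ofInjectiveEndo (coords f e e' x : (Fin 2 → ℂ) →ₗ[ℂ] (Fin 2 → ℂ))
    hi).toContinuousLinearEquiv, by ext; simp⟩

/-- A fiberwise solution of `α ∘ φ = f` is holomorphic where `α` is invertible. -/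
theorem contMDiffAt_of_comp_eq (α : Hom F E) (f : Hom G E) (φ : ∀ x, G.fiber x →ₗ[ℂ] F.fiber x)
    {x : CP1} (hα : Function.Bijective (α.toFun x))
    (h : ∀ᶠ y in 𝓝 x, ∀ v, α.toFun y (φ y v) = f.toFun y v) (v : G.fiber x) :
    ContMDiffAt (𝓘(ℂ, ℂ).prod 𝓘(ℂ, Fin 2 → ℂ)) (𝓘(ℂ, ℂ).prod 𝓘(ℂ, Fin 2 → ℂ)) ω
      (fun v : G.Total => (⟨v.proj, φ v.proj v.snd⟩ : F.Total)) ⟨x, v⟩ := by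
  set eE := trivializationAt (Fin 2 → ℂ) E.fiber x
  set eF := trivializationAt (Fin 2 → ℂ) F.fiber x
  set eG := trivializationAt (Fin 2 → ℂ) G.fiber x
  have hE : x ∈ eE.baseSet := mem_baseSet_trivializationAt _ _ x
  have hF : x ∈ eF.baseSet := mem_baseSet_trivializationAt _ _ x
  have hG : x ∈ eG.baseSet := mem_baseSet_trivializationAt _ _ x
  have heE := isHolomorphicTriv_of_mem_atlas eE
  have heF := isHolomorphicTriv_of_mem_atlas eF
  have heG := isHolomorphicTriv_of_mem_atlas eG
  have hM := contMDiffAt_coords α heF heE hF hE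
  have hN := contMDiffAt_coords f heG heE hG hE
  have hi := isInvertible_coords α.toFun eF eE hF hE hα.1
  have hiy : ∀ᶠ y in 𝓝 x, (coords α.toFun eF eE y).IsInvertible := by
    obtain ⟨A, hA⟩ := hi
    have := ContinuousLinearEquiv.nhds A
    rw [hA] at this
    filter_upwards [hM.continuousAt this] with y hy
    exact hy
  refine contMDiffAt_of_coords φ heG heF hG hF ((contMDiffAt_clm_inverse hM hi).clm_comp hN) ?_ v
  filter_upwards [h, hiy, eE.open_baseSet.mem_nhds hE, eF.open_baseSet.mem_nhds hF,
    eG.open_baseSet.mem_nhds hG] with y hy hiy hEy hFy hGy w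
  obtain ⟨A, hA⟩ := hiy
  have h1 : A (eF ⟨y, φ y w⟩).2 = coords f.toFun eG eE y (eG ⟨y, w⟩).2 := by
    have := coords_apply α.toFun eF eE hFy hEy (φ y w)
    rw [hy, ← coords_apply f.toFun eG eE hGy hEy, ← hA] at this
    exact this
  rw [ContinuousLinearMap.comp_apply, ← hA, ContinuousLinearMap.inverse_equiv, ← h1]
  exact (A.symm_apply_apply _).symm

/-- In the coordinate `ζ` the quotient is the slope of an analytic function at a zero, extended over
the zero by its derivative (`dslope`); it is analytic by shifting the power series. -/
theorem exists_eq_sub_mul {ζ : OpenPartialHomeomorph CP1 ℂ}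
    (hζ : ζ ∈ IsManifold.maximalAtlas 𝓘(ℂ, ℂ) ω CP1) {p : CP1} (hp : p ∈ ζ.source) {g : CP1 → ℂ}
    (hg : ContMDiffAt 𝓘(ℂ, ℂ) 𝓘(ℂ, ℂ) ω g p) (hgp : g p = 0) :
    ∃ h : CP1 → ℂ, ContMDiffAt 𝓘(ℂ, ℂ) 𝓘(ℂ, ℂ) ω h p ∧
      ∀ x ∈ ζ.source, g x = (ζ x - ζ p) * h x := by
  have h1 : ContMDiffAt 𝓘(ℂ, ℂ) 𝓘(ℂ, ℂ) ω ζ.symm (ζ p) :=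
    (contMDiffOn_symm_of_mem_maximalAtlas hζ).contMDiffAt
      (ζ.open_target.mem_nhds (ζ.map_source hp))
  have h2 : ContMDiffAt 𝓘(ℂ, ℂ) 𝓘(ℂ, ℂ) ω ζ p :=
    (contMDiffOn_of_mem_maximalAtlas hζ).contMDiffAt (ζ.open_source.mem_nhds hp)
  have h3 : AnalyticAt ℂ (g ∘ ζ.symm) (ζ p) := by
    rw [← ζ.left_inv hp] at hg
    exact (contMDiffAt_iff_contDiffAt.1 (hg.comp _ h1)).analyticAt
  obtain ⟨P, hP⟩ := h3
  have h4 : ContMDiffAt 𝓘(ℂ, ℂ) 𝓘(ℂ, ℂ) ω (dslope (g ∘ ζ.symm) (ζ p)) (ζ p) :=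
    contMDiffAt_iff_contDiffAt.2 hP.has_fpower_series_dslope_fslope.analyticAt.contDiffAt
  refine ⟨fun x => dslope (g ∘ ζ.symm) (ζ p) (ζ x), h4.comp p h2, fun x hx => ?_⟩
  have := sub_smul_dslope (g ∘ ζ.symm) (ζ p) (ζ x)
  rw [smul_eq_mul] at this
  rw [this]
  simp [ζ.left_inv hx, ζ.left_inv hp, hgp]

/-- Division of a morphism by `diag(1, ζ - ζ(p))`. -/
theorem exists_diag_comp {ζ : OpenPartialHomeomorph CP1 ℂ}
    (hζ : ζ ∈ IsManifold.maximalAtlas 𝓘(ℂ, ℂ) ω CP1) {p : CP1} (hp : p ∈ ζ.source)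
    {N : CP1 → (Fin 2 → ℂ) →L[ℂ] (Fin 2 → ℂ)}
    (hN : ContMDiffAt 𝓘(ℂ, ℂ) 𝓘(ℂ, (Fin 2 → ℂ) →L[ℂ] (Fin 2 → ℂ)) ω N p)
    (hNp : ∀ v, N p v 1 = 0) :
    ∃ K : CP1 → (Fin 2 → ℂ) →L[ℂ] (Fin 2 → ℂ),
      ContMDiffAt 𝓘(ℂ, ℂ) 𝓘(ℂ, (Fin 2 → ℂ) →L[ℂ] (Fin 2 → ℂ)) ω K p ∧
      ∀ x ∈ ζ.source, ∀ v, Matrix.mulVec !![1, 0; 0, ζ x - ζ p] (K x v) = N x v := by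
  have h1 : ∀ j : Fin 2, ∃ h : CP1 → ℂ, ContMDiffAt 𝓘(ℂ, ℂ) 𝓘(ℂ, ℂ) ω h p ∧
      ∀ x ∈ ζ.source, N x (Pi.single j 1) 1 = (ζ x - ζ p) * h x := fun j =>
    exists_eq_sub_mul hζ hp (contMDiffAt_apply hN _ 1) (hNp _)
  choose h hh hN1 using h1
  -- The first row is kept; the second is replaced by its quotients by `ζ - ζ(p)`.
  let K : CP1 → (Fin 2 → ℂ) →L[ℂ] (Fin 2 → ℂ) := fun x => ContinuousLinearMap.pi
    ![(ContinuousLinearMap.proj (R := ℂ) (φ := fun _ : Fin 2 => ℂ) 0).comp (N x),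
      ∑ j, h j x • ContinuousLinearMap.proj (R := ℂ) (φ := fun _ : Fin 2 => ℂ) j]
  have hK0 : ∀ x v, K x v 0 = N x v 0 := fun x v => rfl
  have hK1 : ∀ x v, K x v 1 = h 0 x * v 0 + h 1 x * v 1 := fun x v => by
    simp [K, Fin.sum_univ_two]
  refine ⟨K, contMDiffAt_clm_of_entries fun v i => ?_, fun x hx v => ?_⟩
  · fin_cases i
    · exact contMDiffAt_apply hN v 0
    · refine (((hh 0).mul (contMDiffAt_const (c := v 0))).add
        ((hh 1).mul (contMDiffAt_const (c := v 1)))).congr_of_eventuallyEq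
        (Filter.Eventually.of_forall fun x => hK1 x v)
  · have hv : N x v 1 = v 0 * N x (Pi.single 0 1) 1 + v 1 * N x (Pi.single 1 1) 1 := by
      conv_lhs => rw [pi_eq_sum_univ' v]
      simp [Fin.sum_univ_two]
    ext i
    fin_cases i
    · simp [Matrix.mulVec, dotProduct, Fin.sum_univ_two, hK0]
    · simp only [Matrix.mulVec, dotProduct, Fin.sum_univ_two, Fin.mk_one, Matrix.of_apply,
        Matrix.cons_val_one, Matrix.cons_val_zero, hK1, hv, hN1 _ x hx]
      simp
      ring

end RankTwoBundle

/-! ### The universal property of a Hecke modification. -/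

namespace HeckeModification

variable {E F G : RankTwoBundle} {p : CP1}

/-- A morphism to `E` whose image at `p` is contained in that of the Hecke modification
`α : F → E` factors through `α`. -/
theorem exists_lift (α : HeckeModification E F p) (f : Hom G E)
    (hf : ∀ v : G.fiber p, ∃ w : F.fiber p, α.hom.toFun p w = f.toFun p v) :
    ∃ φ : Hom G F, α.hom.comp φ = f := by
  obtain ⟨ζ, eE, eF, hζ, hp, heE, hE, heF, hF, hα⟩ := α.local_form
  have := heE.linear
  have := heF.linear
  set eG := trivializationAt (Fin 2 → ℂ) G.fiber p
  have hG : p ∈ eG.baseSet := mem_baseSet_trivializationAt _ _ p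
  have heG := isHolomorphicTriv_of_mem_atlas eG
  have hN := contMDiffAt_coords f heG heE hG (hE hp)
  -- In the local form the image of `α` at `p` is the first coordinate axis, so the second
  -- coordinate of `f` vanishes at `p`.
  have hNp : ∀ v, coords f.toFun eG eE p v 1 = 0 := fun v => by
    obtain ⟨w, hw⟩ := hf (eG.symm p v)
    rw [coords_apply' _ _ _ hG (hE hp), ← hw, hα p hp]
    simp [Matrix.mulVec, dotProduct, Fin.sum_univ_two]
  obtain ⟨K, hK, hKN⟩ := exists_diag_comp hζ hp hN hNp
  classical
  -- Near `p` the lift is the quotient matrix `K`, elsewhere `α⁻¹ ∘ f`. Agreement on overlaps needs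
  -- no check: `α ∘ φ = f` holds everywhere and yields holomorphy away from `p`.
  let φ : ∀ x, G.fiber x →ₗ[ℂ] F.fiber x := fun x =>
    if h : x ∈ ζ.source ∩ eG.baseSet then
      eF.symmₗ ℂ x ∘ₗ (K x : (Fin 2 → ℂ) →ₗ[ℂ] (Fin 2 → ℂ)) ∘ₗ eG.linearMapAt ℂ x
    else (LinearEquiv.ofBijective (α.hom.toFun x)
      (α.bijective x fun hx => h (hx ▸ ⟨hp, hG⟩))).symm.toLinearMap ∘ₗ f.toFun x
  have hφ1 : ∀ x ∈ ζ.source ∩ eG.baseSet, ∀ v, (eF ⟨x, φ x v⟩).2 = K x (eG ⟨x, v⟩).2 := by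
    intro x hx v
    simp only [φ, dif_pos hx, LinearMap.comp_apply, Trivialization.symmₗ_apply _ (hF hx.1),
      triv_symm eF (hF hx.1), Trivialization.coe_linearMapAt_of_mem _ hx.2]
    rfl
  have hφ : ∀ x v, α.hom.toFun x (φ x v) = f.toFun x v := by
    intro x v
    by_cases hx : x ∈ ζ.source ∩ eG.baseSet
    · refine triv_injective eE (hE hx.1) ?_
      rw [hα x hx.1, hφ1 x hx, hKN x hx.1, coords_apply _ _ _ hx.2 (hE hx.1)]
    · simp only [φ, dif_neg hx, LinearMap.comp_apply]
      exact LinearEquiv.apply_symm_apply (LinearEquiv.ofBijective (α.hom.toFun x) _) _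
  refine ⟨⟨φ, ?_⟩, Hom.ext_apply hφ⟩
  rintro ⟨x, v⟩
  by_cases hx : x = p
  · subst hx
    refine contMDiffAt_of_coords φ heG heF hG (hF hp) hK ?_ v
    filter_upwards [(ζ.open_source.inter eG.open_baseSet).mem_nhds ⟨hp, hG⟩] with y hy w
    exact hφ1 y hy w
  · exact contMDiffAt_of_comp_eq α.hom f φ (α.bijective x hx) (Filter.Eventually.of_forall hφ) v

end HeckeModification

/-! ### Sequences are classified by their lines at the points `pᵢ`. -/

namespace HeckeSequence

variable {E G : RankTwoBundle} {n : ℕ} {p : Fin n → CP1}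

theorem compHom_succ (s : HeckeSequence E p) (i : Fin n) :
    s.compHom i.succ = (s.compHom i.castSucc).comp (s.modification i).hom := rfl

theorem bijective_compHom (s : HeckeSequence E p) {x : CP1} (i : Fin (n + 1))
    (hx : ∀ j : Fin n, j.castSucc < i → x ≠ p j) :
    Function.Bijective ((s.compHom i).toFun x) := by
  induction i using Fin.induction with
  | zero => exact Function.bijective_id
  | succ i ih =>
    rw [compHom_succ]
    exact (ih fun j hj => hx j (hj.trans i.castSucc_lt_succ)).comp
      ((s.modification i).bijective x (hx i i.castSucc_lt_succ))

/-- This is where distinctness of the points enters: the line in the fiber of the preceding bundle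
at `p i` can be carried to the fiber of `E` without loss. -/
theorem bijective_compHom_castSucc (s : HeckeSequence E p) (hp : Function.Injective p)
    (i : Fin n) : Function.Bijective ((s.compHom i.castSucc).toFun (p i)) :=
  s.bijective_compHom _ fun _ hj h => (Fin.castSucc_lt_castSucc_iff.1 hj).ne' (hp h)

/-- The composite is injective on fibers off the finite set of modification points, hence a
monomorphism. -/
theorem compHom_cancel (s : HeckeSequence E p) (i : Fin (n + 1)) {f g : Hom G (chain E s.bundle i)}
    (h : (s.compHom i).comp f = (s.compHom i).comp g) : f = g := by
  refine Hom.eq_of_finite (range p) (finite_range p) fun x hx => LinearMap.ext fun v => ?_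
  refine (s.bijective_compHom i fun j _ hj => hx ⟨j, hj.symm⟩).1 ?_
  exact congrArg (fun k : Hom G E => k.toFun x v) h

/-- A morphism to `E` whose image at each `p j` is contained in that of `α₁ ∘ ⋯ ∘ αⱼ` factors
through the sequence. -/
theorem exists_lift (s : HeckeSequence E p) (hp : Function.Injective p) (f : Hom G E)
    (i : Fin (n + 1)) (hf : ∀ j : Fin n, j.castSucc < i →
      range (f.toFun (p j)) ⊆ range ((s.compHom j.succ).toFun (p j))) :
    ∃ φ : Hom G (chain E s.bundle i), (s.compHom i).comp φ = f := by
  induction i using Fin.induction with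
  | zero => exact ⟨f, rfl⟩
  | succ i ih =>
    obtain ⟨φ, rfl⟩ := ih fun j hj => hf j (hj.trans i.castSucc_lt_succ)
    obtain ⟨χ, rfl⟩ := (s.modification i).exists_lift φ fun v => by
      obtain ⟨w, hw⟩ := hf i i.castSucc_lt_succ ⟨v, rfl⟩
      -- `hw` is an equation in the fiber of `E`; injectivity of the preceding composite at `p i`
      -- brings it down to the preceding bundle.
      exact ⟨w, (s.bijective_compHom_castSucc hp i).1 hw⟩
    exact ⟨χ, rfl⟩

theorem range_compHom_subset (s : HeckeSequence E p) (x : CP1) {i j : Fin (n + 1)} (h : j ≤ i) :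
    range ((s.compHom i).toFun x) ⊆ range ((s.compHom j).toFun x) := by
  induction i using Fin.induction with
  | zero => rw [Fin.le_zero_iff.1 h]
  | succ i ih =>
    rcases h.lt_or_eq with h | rfl
    · refine Subset.trans ?_ (ih (Fin.le_castSucc_iff.2 h))
      rintro _ ⟨v, rfl⟩
      exact ⟨_, rfl⟩
    · exact Subset.rfl

/-- Each composite lifts through the other sequence, since images only shrink along a sequence.
Cancelling the composites makes the lifts mutually inverse and gives the commuting squares. -/
theorem equivalent_of_range_eq (s s' : HeckeSequence E p) (hp : Function.Injective p)
    (h : ∀ i : Fin n, range ((s.compHom i.succ).toFun (p i)) =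
      range ((s'.compHom i.succ).toFun (p i))) : Equivalent s s' := by
  have h1 : ∀ i, ∃ φ : Hom (chain E s.bundle i) (chain E s'.bundle i),
      (s'.compHom i).comp φ = s.compHom i := fun i =>
    s'.exists_lift hp _ i fun j hj =>
      h j ▸ s.range_compHom_subset _ (Fin.castSucc_lt_iff_succ_le.1 hj)
  have h2 : ∀ i, ∃ φ : Hom (chain E s'.bundle i) (chain E s.bundle i),
      (s.compHom i).comp φ = s'.compHom i := fun i =>
    s.exists_lift hp _ i fun j hj =>
      h j ▸ s'.range_compHom_subset _ (Fin.castSucc_lt_iff_succ_le.1 hj)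
  choose φ hφ using h1
  choose χ hχ using h2
  let Φ : ∀ i : Fin (n + 1), Iso (chain E s.bundle i) (chain E s'.bundle i) := fun i =>
    ⟨φ i, χ i,
      s.compHom_cancel i ((congrArg (fun k : Hom _ E => k.comp (φ i)) (hχ i)).trans (hφ i)),
      s'.compHom_cancel i ((congrArg (fun k : Hom _ E => k.comp (χ i)) (hφ i)).trans (hχ i))⟩
  let Ψ : ∀ i : Fin n, Iso (s.bundle i) (s'.bundle i) := fun i => Φ i.succ
  have h3 : ∀ i, (chainIso (E := E) Ψ i).hom = φ i := by
    intro i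
    cases i using Fin.cases with
    | zero => exact (hφ 0).symm
    | succ i => rfl
  refine ⟨Ψ, fun i => s'.compHom_cancel i.castSucc ?_⟩
  rw [h3, h3]
  calc (s'.compHom i.castSucc).comp ((φ i.castSucc).comp (s.modification i).hom)
      = ((s'.compHom i.castSucc).comp (φ i.castSucc)).comp (s.modification i).hom := rfl
    _ = s.compHom i.succ := by rw [hφ]; rfl
    _ = (s'.compHom i.succ).comp (φ i.succ) := (hφ _).symm
    _ = _ := rfl

/-- Because the isomorphisms start with the identity of `E`, the composites differ only by an
isomorphism of the source. -/
theorem range_eq_of_equivalent {s s' : HeckeSequence E p} (h : Equivalent s s') (i : Fin (n + 1))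
    (x : CP1) : range ((s.compHom i).toFun x) = range ((s'.compHom i).toFun x) := by
  have key : ∀ {s s' : HeckeSequence E p}, Equivalent s s' → ∀ i : Fin (n + 1),
      range ((s.compHom i).toFun x) ⊆ range ((s'.compHom i).toFun x) := by
    rintro s s' ⟨φ, h⟩ i
    have h1 : s.compHom i = (s'.compHom i).comp (chainIso (E := E) φ i).hom := by
      induction i using Fin.induction with
      | zero => rfl
      | succ i ih =>
        rw [compHom_succ, ih]
        calc _ = (s'.compHom i.castSucc).comp
              ((chainIso (E := E) φ i.castSucc).hom.comp (s.modification i).hom) := rfl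
          _ = _ := by rw [h i]; rfl
    rw [h1]
    rintro _ ⟨v, rfl⟩
    exact ⟨_, rfl⟩
  exact (key h i).antisymm (key (equivalent_equivalence.symm h) i)

/-- Equivalent sequences have isomorphic terminal bundles. -/
theorem nonempty_iso_terminal {s s' : HeckeSequence E p} (h : Equivalent s s') :
    Nonempty (Iso s.terminal s'.terminal) :=
  let ⟨φ, _⟩ := h
  ⟨chainIso (E := E) φ (Fin.last n)⟩

/-- Prepend a Hecke modification to a sequence of Hecke modifications. -/
def cons {p : Fin (n + 1) → CP1} {F : RankTwoBundle} (α : HeckeModification E F (p 0))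
    (s : HeckeSequence F fun i => p i.succ) : HeckeSequence E p where
  bundle := chain F s.bundle
  modification := Fin.cases α s.modification

theorem compHom_cons {p : Fin (n + 1) → CP1} {F : RankTwoBundle}
    (α : HeckeModification E F (p 0)) (s : HeckeSequence F fun i => p i.succ) (i : Fin (n + 1)) :
    (cons α s).compHom i.succ = α.hom.comp (s.compHom i) := by
  induction i using Fin.induction with
  | zero => rfl
  | succ i ih =>
    rw [compHom_succ, compHom_succ]
    exact congrArg (fun k => Hom.comp k (s.modification i).hom) ih

theorem terminal_cons {p : Fin (n + 1) → CP1} {F : RankTwoBundle}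
    (α : HeckeModification E F (p 0)) (s : HeckeSequence F fun i => p i.succ) :
    (cons α s).terminal = s.terminal := rfl

end HeckeSequence

/-! ### Taylor expansions and the map `η` -/

/-- The Taylor series of a function at a point. -/
def taylorSeries (f : ℂ → ℂ) (μ : ℂ) : ℂ⟦X⟧ :=
  PowerSeries.mk fun k => iteratedDeriv k f μ / (k.factorial : ℂ)

theorem taylorSeries_congr {f g : ℂ → ℂ} {μ : ℂ} (h : f =ᶠ[𝓝 μ] g) :
    taylorSeries f μ = taylorSeries g μ := by
  ext k
  simp [taylorSeries, h.iteratedDeriv_eq]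

theorem taylorSeries_mul {f g : ℂ → ℂ} {μ : ℂ} (hf : AnalyticAt ℂ f μ) (hg : AnalyticAt ℂ g μ) :
    taylorSeries (fun z => f z * g z) μ = taylorSeries f μ * taylorSeries g μ := by
  ext n
  simp only [taylorSeries, PowerSeries.coeff_mk, iteratedDeriv_fun_mul hf.contDiffAt hg.contDiffAt,
    PowerSeries.coeff_mul, Finset.sum_div, Finset.Nat.sum_antidiagonal_eq_sum_range_succ_mk,
    Nat.succ_eq_add_one]
  refine Finset.sum_congr rfl fun i hi => ?_
  -- Leibniz' rule: the binomial coefficient is absorbed by the factorials of the Taylor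
  -- coefficients.
  rw [Nat.cast_choose _ (by grind)]
  field_simp [Nat.factorial_ne_zero]

theorem constantCoeff_taylorSeries (f : ℂ → ℂ) (μ : ℂ) :
    PowerSeries.constantCoeff (taylorSeries f μ) = f μ := by
  rw [← PowerSeries.coeff_zero_eq_constantCoeff_apply]
  simp [taylorSeries]

theorem taylorSeries_sub_self (μ : ℂ) : taylorSeries (fun z => z - μ) μ = PowerSeries.X := by
  ext n
  rcases n with _ | n
  · simp [taylorSeries]
  · have : deriv (fun z : ℂ => z - μ) = fun _ => 1 := by
      funext z
      simp
    simp only [taylorSeries, PowerSeries.coeff_mk, iteratedDeriv_succ', this, iteratedDeriv_const,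
      PowerSeries.coeff_X]
    rcases n with _ | n <;> simp

/-- The value at `0` of an invertible matrix of power series is invertible. -/
theorem isUnit_map_constantCoeff (C : GL (Fin 2) ℂ⟦X⟧) :
    IsUnit ((C : Matrix (Fin 2) (Fin 2) ℂ⟦X⟧).map (PowerSeries.constantCoeff (R := ℂ))) :=
  C.isUnit.map (PowerSeries.constantCoeff (R := ℂ)).mapMatrix

theorem map_diag_X : (!![1, 0; 0, PowerSeries.X] : Matrix (Fin 2) (Fin 2) ℂ⟦X⟧).map
    (HahnSeries.ofPowerSeries ℤ ℂ) = (matZ : Matrix (Fin 2) (Fin 2) (LaurentSeries ℂ)) := by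
  ext i j
  fin_cases i <;> fin_cases j <;> simp [matZ, Matrix.GeneralLinearGroup.mkOfDetNeZero]

/-- The expansion is `B diag(1, z) C` with `B`, `C` invertible over power series. At the point it
becomes `B(0) diag(1, 0) C(0)`, whose range is spanned by the first column of `B(0)`. -/
theorem HasEta.range_eq {A : ℂ → Matrix (Fin 2) (Fin 2) ℂ} {μ : ℂ} {L : CP1} (h : HasEta A μ L) :
    range (A μ).mulVec = L.submodule := by
  obtain ⟨g, ⟨B, hB⟩, hg, rfl⟩ := h
  have heta : eta ⟨(g : AffineGrassmannian), ⟨B, hB⟩⟩ =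
      Projectivization.mk ℂ (firstColumn B) (firstColumn_ne_zero B) := by
    rw [← eta_mk]
    congr 1
    exact Subtype.ext hB.symm
  rw [heta, Projectivization.submodule_mk]
  obtain ⟨C, hC⟩ := QuotientGroup.eq.1 hB
  have h1 : g = powerToLaurent B * matZ * powerToLaurent C := by rw [hC, mul_inv_cancel_left]
  have h2 : taylorMatrix A μ = (B : Matrix (Fin 2) (Fin 2) ℂ⟦X⟧) * !![1, 0; 0, PowerSeries.X] *
      (C : Matrix (Fin 2) (Fin 2) ℂ⟦X⟧) := by
    have hinj : Function.Injective (fun M : Matrix (Fin 2) (Fin 2) ℂ⟦X⟧ =>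
        M.map (HahnSeries.ofPowerSeries ℤ ℂ)) :=
      Matrix.map_injective (HahnSeries.ofPowerSeries_injective (Γ := ℤ) (R := ℂ))
    apply hinj
    dsimp only
    rw [← hg, h1, Matrix.map_mul, Matrix.map_mul, Units.val_mul, Units.val_mul]
    rw [map_diag_X]
    rfl
  have h3 : A μ = (B : Matrix (Fin 2) (Fin 2) ℂ⟦X⟧).map (PowerSeries.constantCoeff (R := ℂ)) *
      !![1, 0; 0, 0] * (C : Matrix (Fin 2) (Fin 2) ℂ⟦X⟧).map
        (PowerSeries.constantCoeff (R := ℂ)) := by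
    have hT : A μ = (taylorMatrix A μ).map (PowerSeries.constantCoeff (R := ℂ)) := by
      ext i j
      exact (constantCoeff_taylorSeries (fun z => A z i j) μ).symm
    rw [hT, h2, Matrix.map_mul, Matrix.map_mul]
    congr 2
    ext i j
    fin_cases i <;> fin_cases j <;> simp
  have h4 : ∀ v, (A μ).mulVec v = (((C : Matrix (Fin 2) (Fin 2) ℂ⟦X⟧).map
      (PowerSeries.constantCoeff (R := ℂ))).mulVec v 0) • firstColumn B := by
    intro v
    rw [h3, ← Matrix.mulVec_mulVec, ← Matrix.mulVec_mulVec]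
    ext i
    simp [Matrix.mulVec, dotProduct, Fin.sum_univ_two, firstColumn, mul_comm]
  ext w
  simp only [mem_range, h4, SetLike.mem_coe, Submodule.mem_span_singleton]
  constructor
  · rintro ⟨v, rfl⟩
    exact ⟨_, rfl⟩
  · rintro ⟨t, rfl⟩
    obtain ⟨v, hv⟩ := (Matrix.mulVec_surjective_iff_isUnit.2 (isUnit_map_constantCoeff C)) ![t, 0]
    exact ⟨v, by rw [hv]; rfl⟩

/-- Taylor expansion is multiplicative, and the expansions of `N` and of `diag(1, u)` are invertible
because their values at `μ` are. They serve as `B` and `C` in `B diag(1, z) C`. -/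
theorem exists_hasEta_of_eventuallyEq {A N : ℂ → Matrix (Fin 2) (Fin 2) ℂ} {μ : ℂ} {u : ℂ → ℂ}
    (hN : ∀ i j, AnalyticAt ℂ (fun z => N z i j) μ) (hdet : (N μ).det ≠ 0) (hu : AnalyticAt ℂ u μ)
    (hu0 : u μ ≠ 0) (hA : ∀ᶠ z in 𝓝 μ, A z = N z * !![1, 0; 0, (z - μ) * u z]) :
    ∃ L, HasEta A μ L := by
  have hB : IsUnit (taylorMatrix N μ).det := by
    rw [PowerSeries.isUnit_iff_constantCoeff, RingHom.map_det]
    have : (PowerSeries.constantCoeff (R := ℂ)).mapMatrix (taylorMatrix N μ) = N μ := by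
      ext i j
      exact constantCoeff_taylorSeries (fun z => N z i j) μ
    rw [this]
    exact hdet.isUnit
  have hC : IsUnit (!![1, 0; 0, taylorSeries u μ] : Matrix (Fin 2) (Fin 2) ℂ⟦X⟧).det := by
    rw [Matrix.det_fin_two_of, PowerSeries.isUnit_iff_constantCoeff]
    simpa [constantCoeff_taylorSeries] using hu0
  let B : GL (Fin 2) ℂ⟦X⟧ := Matrix.nonsingInvUnit _ hB
  let C : GL (Fin 2) ℂ⟦X⟧ := Matrix.nonsingInvUnit _ hC
  have hg : ((powerToLaurent B * matZ * powerToLaurent C : GL (Fin 2) (LaurentSeries ℂ)) :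
      AffineGrassmannian) ∈ bruhatCell := by
    refine ⟨B, QuotientGroup.eq.2 ⟨C, ?_⟩⟩
    rw [inv_mul_cancel_left]
  refine ⟨_, powerToLaurent B * matZ * powerToLaurent C, hg, ?_, rfl⟩
  have h1 : taylorMatrix A μ = taylorMatrix N μ * !![1, 0; 0, PowerSeries.X] *
      !![1, 0; 0, taylorSeries u μ] := by
    have h2 : ∀ i, taylorSeries (fun z => A z i 0) μ = taylorSeries (fun z => N z i 0) μ := by
      intro i
      refine taylorSeries_congr ?_
      filter_upwards [hA] with z hz
      simp [hz, Matrix.mul_apply, Fin.sum_univ_two]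
    have h3 : ∀ i, taylorSeries (fun z => A z i 1) μ =
        taylorSeries (fun z => N z i 1) μ * (PowerSeries.X * taylorSeries u μ) := by
      intro i
      rw [← taylorSeries_sub_self μ, ← taylorSeries_mul (by fun_prop) hu,
        ← taylorSeries_mul (g := fun z => (z - μ) * u z) (hN i 1) (by fun_prop)]
      refine taylorSeries_congr ?_
      filter_upwards [hA] with z hz
      simp [hz, Matrix.mul_apply, Fin.sum_univ_two]
    ext1 i j
    rw [Matrix.mul_assoc]
    fin_cases j
    · refine (h2 i).trans ?_
      simp [Matrix.mul_apply, Fin.sum_univ_two, taylorMatrix, taylorSeries]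
    · refine (h3 i).trans ?_
      simp [Matrix.mul_apply, Fin.sum_univ_two, taylorMatrix, taylorSeries]
  rw [h1, Matrix.map_mul, Matrix.map_mul, Units.val_mul, Units.val_mul]
  rw [map_diag_X]
  rfl

/-! ### Directions of a sequence of Hecke modifications -/

/-- The trivialization of `𝒪(a) ⊕ 𝒪(b)` over `U i`. -/
def frame (a b : ℤ) (i : Fin 2) : (splitBundle a b).Triv :=
  (splitCore ![a, b]).localTriv i

theorem mem_frame_baseSet {a b : ℤ} {i : Fin 2} {x : CP1} :
    x ∈ (frame a b i).baseSet ↔ x ∈ CP1.U i := Iff.rfl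

theorem isHolomorphicTriv_frame (a b : ℤ) (i : Fin 2) : IsHolomorphicTriv (frame a b i) := by
  have : MemTrivializationAtlas (frame a b i) :=
    ⟨mem_range_self i⟩
  exact isHolomorphicTriv_of_mem_atlas _

instance (a b : ℤ) (i : Fin 2) : (frame a b i).IsLinear ℂ := (isHolomorphicTriv_frame a b i).linear

theorem frame_apply (a b : ℤ) (i : Fin 2) (x : CP1) (v : (splitBundle a b).fiber x) (k : Fin 2) :
    (frame a b i ⟨x, v⟩).2 k =
      transition (CP1.idx x) i x ^ (![a, b] : Fin 2 → ℤ) k * (show Fin 2 → ℂ from v) k := rfl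

theorem frame_zero_apply (i : Fin 2) (x : CP1) (v : (splitBundle 0 0).fiber x) :
    (frame 0 0 i ⟨x, v⟩).2 = (show Fin 2 → ℂ from v) := by
  ext k
  rw [frame_apply]
  fin_cases k <;> simp

theorem standardTriv_eq (a b : ℤ) : standardTriv a b = frame a b 0 := rfl

theorem contMDiff_pt (i : Fin 2) : ContMDiff 𝓘(ℂ, ℂ) 𝓘(ℂ, ℂ) ω (CP1.pt i) := by
  have : ContMDiffOn 𝓘(ℂ, ℂ) 𝓘(ℂ, ℂ) ω (CP1.chart i).symm (CP1.chart i).target :=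
    contMDiffOn_symm_of_mem_maximalAtlas (IsManifold.subset_maximalAtlas (mem_range_self i))
  exact contMDiffOn_univ.1 this

theorem analyticAt_comp_pt {g : CP1 → ℂ} {i : Fin 2} {z : ℂ}
    (hg : ContMDiffAt 𝓘(ℂ, ℂ) 𝓘(ℂ, ℂ) ω g (CP1.pt i z)) :
    AnalyticAt ℂ (fun z => g (CP1.pt i z)) z :=
  (contMDiffAt_iff_contDiffAt.1 (hg.comp z (contMDiff_pt i z))).analyticAt

theorem localMatrix_eq {E F : RankTwoBundle} (ψE : E.Triv) (ψF : F.Triv) [ψE.IsLinear ℂ]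
    [ψF.IsLinear ℂ] (α : Hom F E) {z : ℂ} (hE : CP1.pt 0 z ∈ ψE.baseSet)
    (hF : CP1.pt 0 z ∈ ψF.baseSet) :
    localMatrix ψE ψF α z = LinearMap.toMatrix'
      (coords α.toFun ψF ψE (CP1.pt 0 z) : (Fin 2 → ℂ) →ₗ[ℂ] (Fin 2 → ℂ)) := by
  ext i j
  rw [LinearMap.toMatrix'_apply, ContinuousLinearMap.coe_coe, coords_apply' _ _ _ hF hE]
  simp only [localMatrix, Matrix.of_apply]

theorem range_localMatrix {F : RankTwoBundle} (ψ : F.Triv) [ψ.IsLinear ℂ]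
    (α : Hom F (splitBundle 0 0)) {x : CP1} (hx : x ∈ CP1.U 0) (hψ : x ∈ ψ.baseSet) :
    range (localMatrix (standardTriv 0 0) ψ α (CP1.ξ 0 x)).mulVec =
      (range (α.toFun x) : Set (Fin 2 → ℂ)) := by
  obtain ⟨z, rfl⟩ : ∃ z, x = CP1.pt 0 z := ⟨_, (CP1.pt_ξ 0 x hx).symm⟩
  rw [CP1.ξ_pt, standardTriv_eq, localMatrix_eq _ _ _ (mem_frame_baseSet.2 hx) hψ]
  ext w
  simp only [mem_range, LinearMap.toMatrix'_mulVec, ContinuousLinearMap.coe_coe]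
  constructor
  · rintro ⟨v, rfl⟩
    refine ⟨ψ.symm _ v, ?_⟩
    rw [coords_apply' _ _ _ hψ (mem_frame_baseSet.2 hx), frame_zero_apply]
  · rintro ⟨v, rfl⟩
    refine ⟨(ψ ⟨_, v⟩).2, ?_⟩
    rw [coords_apply _ _ _ hψ (mem_frame_baseSet.2 hx), frame_zero_apply]

/-- Dividing either coordinate difference by the other gives holomorphic quotients `h` and `k` with
`h * k = 1` off `p`, hence at `p` by continuity. -/
theorem exists_eq_sub_mul_ne_zero {ζ : OpenPartialHomeomorph CP1 ℂ}
    (hζ : ζ ∈ IsManifold.maximalAtlas 𝓘(ℂ, ℂ) ω CP1) {p : CP1} (hp : p ∈ ζ.source)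
    (hU : p ∈ CP1.U 0) :
    ∃ h : CP1 → ℂ, ContMDiffAt 𝓘(ℂ, ℂ) 𝓘(ℂ, ℂ) ω h p ∧ h p ≠ 0 ∧
      ∀ x ∈ CP1.U 0, ζ x - ζ p = (CP1.ξ 0 x - CP1.ξ 0 p) * h x := by
  have hζ0 : CP1.chart 0 ∈ IsManifold.maximalAtlas 𝓘(ℂ, ℂ) ω CP1 :=
    IsManifold.subset_maximalAtlas (mem_range_self 0)
  have h1 : ContMDiffAt 𝓘(ℂ, ℂ) 𝓘(ℂ, ℂ) ω (fun x => ζ x - ζ p) p :=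
    ((contMDiffOn_of_mem_maximalAtlas hζ).contMDiffAt (ζ.open_source.mem_nhds hp)).sub
      contMDiffAt_const
  have h2 : ContMDiffAt 𝓘(ℂ, ℂ) 𝓘(ℂ, ℂ) ω (fun x => CP1.ξ 0 x - CP1.ξ 0 p) p :=
    ((contMDiffOn_ξ 0).contMDiffAt ((CP1.isOpen_U 0).mem_nhds hU)).sub contMDiffAt_const
  obtain ⟨h, hh, hζh⟩ := exists_eq_sub_mul hζ0 hU h1 (sub_self _)
  obtain ⟨k, hk, hξk⟩ := exists_eq_sub_mul hζ hp h2 (sub_self _)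
  refine ⟨h, hh, fun h0 => ?_, hζh⟩
  have h3 : h p * k p = 1 := by
    refine tendsto_nhds_unique_of_eventuallyEq (l := 𝓝[≠] p)
      ((hh.continuousAt.mul hk.continuousAt).tendsto.mono_left nhdsWithin_le_nhds)
      tendsto_const_nhds ?_
    filter_upwards [nhdsWithin_le_nhds (ζ.open_source.mem_nhds hp),
      nhdsWithin_le_nhds ((CP1.isOpen_U 0).mem_nhds hU), self_mem_nhdsWithin] with x hx hx0 hxp
    have h4 : ζ x - ζ p ≠ 0 := sub_ne_zero.2 fun h => hxp (ζ.injOn hx hp h)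
    have h5 : ζ x - ζ p = (CP1.ξ 0 x - CP1.ξ 0 p) * h x := hζh x hx0
    have h6 := hξk x hx
    rw [h6] at h5
    apply mul_left_cancel₀ h4
    rw [mul_one, Pi.mul_apply]
    linear_combination -h5
  rw [h0, zero_mul] at h3
  exact zero_ne_one h3

/-- The composition of a Hecke modification with a morphism that is invertible near `p` has a
direction. -/
theorem HeckeModification.exists_hasEta {E F : RankTwoBundle} {p : CP1}
    (α : HeckeModification E F p) (hU : p ∈ CP1.U 0) (β : Hom E (splitBundle 0 0))
    (hβ : Function.Bijective (β.toFun p)) :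
    ∃ (ψ : F.Triv) (L : CP1), IsHolomorphicTriv ψ ∧ p ∈ ψ.baseSet ∧
      HasEta (localMatrix (standardTriv 0 0) ψ (β.comp α.hom)) (CP1.ξ 0 p) L := by
  obtain ⟨ζ, eE, eF, hζ, hp, heE, hE, heF, hF, hα⟩ := α.local_form
  have := heE.linear
  have := heF.linear
  obtain ⟨h, hh, hh0, hζh⟩ := exists_eq_sub_mul_ne_zero hζ hp hU
  have hpt : CP1.pt 0 (CP1.ξ 0 p) = p := CP1.pt_ξ 0 p hU
  let M : CP1 → (Fin 2 → ℂ) →L[ℂ] (Fin 2 → ℂ) := coords β.toFun eE (frame 0 0 0)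
  have hM := contMDiffAt_coords β heE (isHolomorphicTriv_frame 0 0 0) (hE hp)
    (mem_frame_baseSet.2 hU)
  -- The matrix of `β ∘ α` is that of `β` times `diag(1, ζ - ζ(p))`, and `ζ - ζ(p)` is `z - μ` times
  -- the nonvanishing `h`.
  obtain ⟨L, hL⟩ := exists_hasEta_of_eventuallyEq
    (A := localMatrix (standardTriv 0 0) eF (β.comp α.hom))
    (N := fun z => LinearMap.toMatrix' (M (CP1.pt 0 z) : (Fin 2 → ℂ) →ₗ[ℂ] (Fin 2 → ℂ)))
    (μ := CP1.ξ 0 p) (u := fun z => h (CP1.pt 0 z))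
    (fun i j => by
      simp only [LinearMap.toMatrix'_apply]
      exact analyticAt_comp_pt (hpt.symm ▸ contMDiffAt_apply hM _ i))
    (by
      rw [hpt]
      obtain ⟨A, hA⟩ := isInvertible_coords β.toFun eE (frame 0 0 0) (hE hp)
        (mem_frame_baseSet.2 hU) hβ.1
      rw [LinearMap.det_toMatrix']
      change LinearMap.det ((coords β.toFun eE (frame 0 0 0) p :
        (Fin 2 → ℂ) →L[ℂ] (Fin 2 → ℂ)) : (Fin 2 → ℂ) →ₗ[ℂ] (Fin 2 → ℂ)) ≠ 0
      rw [← hA]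
      exact A.toLinearEquiv.isUnit_det'.ne_zero)
    (analyticAt_comp_pt (hpt.symm ▸ hh)) (by rwa [hpt])
    (by
      have h1 : ∀ᶠ z in 𝓝 (CP1.ξ 0 p), CP1.pt 0 z ∈ ζ.source := by
        refine (CP1.continuous_pt 0).continuousAt.eventually_mem ?_
        rw [hpt]
        exact ζ.open_source.mem_nhds hp
      filter_upwards [h1] with z hz
      have hzU := CP1.pt_mem_U 0 z
      have h2 : z - CP1.ξ 0 p = CP1.ξ 0 (CP1.pt 0 z) - CP1.ξ 0 p := by rw [CP1.ξ_pt]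
      rw [h2, ← hζh _ hzU, standardTriv_eq, localMatrix_eq _ _ _ (mem_frame_baseSet.2 hzU) (hF hz)]
      apply Matrix.toLin'.injective
      rw [Matrix.toLin'_toMatrix', Matrix.toLin'_mul, Matrix.toLin'_toMatrix']
      refine LinearMap.ext fun v => ?_
      rw [ContinuousLinearMap.coe_coe, coords_apply' _ _ _ (hF hz) (mem_frame_baseSet.2 hzU),
        Hom.comp_apply, ← coords_apply β.toFun eE (frame 0 0 0) (hE hz) (mem_frame_baseSet.2 hzU),
        hα _ hz, triv_symm eF (hF hz)]
      rfl)
  exact ⟨eF, L, heF, hF hp, hL⟩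

/-! ### The map `h` is well-defined and injective. -/

namespace HeckeSequence

variable {n : ℕ} {p : Fin n → CP1}

/-- The right-hand side involves no trivialization, which makes the directions independent of that
choice. For the converse, the local form supplies some direction, and its line identifies it with `a
i`. -/
theorem hasDirections_iff (hp : Function.Injective p) (hU : ∀ i, p i ∈ CP1.U 0)
    (s : HeckeSequence (splitBundle 0 0) p) (a : Fin n → CP1) :
    HasDirections s a ↔ ∀ i, (range ((s.compHom i.succ).toFun (p i)) : Set (Fin 2 → ℂ)) =
      (a i).submodule := by
  refine forall_congr' fun i => ⟨?_, fun h => ?_⟩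
  · rintro ⟨ψ, hψ, hpψ, h⟩
    have := hψ.linear
    rw [← h.range_eq, range_localMatrix ψ _ (hU i) hpψ]
  · obtain ⟨ψ, L, hψ, hpψ, hL⟩ := (s.modification i).exists_hasEta (hU i) (s.compHom i.castSucc)
      (s.bijective_compHom_castSucc hp i)
    have := hψ.linear
    refine ⟨ψ, hψ, hpψ, ?_⟩
    have h1 := hL.range_eq
    rw [range_localMatrix ψ _ (hU i) hpψ] at h1
    have h2 : L = a i := Projectivization.submodule_injective
      (SetLike.coe_injective (h1.symm.trans h))
    exact h2 ▸ hL

theorem exists_hasDirections (hp : Function.Injective p) (hU : ∀ i, p i ∈ CP1.U 0)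
    (s : HeckeSequence (splitBundle 0 0) p) : ∃ a, HasDirections s a := by
  choose ψ L h using fun i => (s.modification i).exists_hasEta (hU i) (s.compHom i.castSucc)
      (s.bijective_compHom_castSucc hp i)
  exact ⟨L, fun i => ⟨ψ i, h i⟩⟩

theorem hasDirections_iff_heckeMap (hp : Function.Injective p) (hU : ∀ i, p i ∈ CP1.U 0)
    (s : HeckeSequence (splitBundle 0 0) p) (a : Fin n → CP1) :
    HasDirections s a ↔ heckeMap p s.toTot = a := by
  obtain ⟨b, hb⟩ := s.exists_hasDirections hp hU
  -- The choice in `heckeMap` yields directions of some representative `s'`, perhaps not `s`;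
  -- invariance of the lines transfers them to `s`.
  obtain ⟨s', hs', h⟩ : ∃ s' : HeckeSequence (splitBundle 0 0) p, s'.toTot = s.toTot ∧
      HasDirections s' (heckeMap p s.toTot) := Classical.epsilon_spec (p := fun a =>
    ∃ s' : HeckeSequence (splitBundle 0 0) p, s'.toTot = s.toTot ∧ HasDirections s' a)
    ⟨b, s, rfl, hb⟩
  have h1 : HasDirections s (heckeMap p s.toTot) := by
    rw [hasDirections_iff hp hU] at h ⊢
    exact fun i => (range_eq_of_equivalent (Quotient.exact hs') i.succ (p i)).symm.trans (h i)
  refine ⟨fun h2 => ?_, fun h2 => h2 ▸ h1⟩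
  rw [hasDirections_iff hp hU] at h1 h2
  exact funext fun i => Projectivization.submodule_injective
    (SetLike.coe_injective ((h1 i).symm.trans (h2 i)))

theorem injective_heckeMap (hp : Function.Injective p) (hU : ∀ i, p i ∈ CP1.U 0) :
    Function.Injective (heckeMap p) := by
  intro x y h
  induction x using Quotient.inductionOn with | _ s => ?_
  induction y using Quotient.inductionOn with | _ s' => ?_
  have h1 := (hasDirections_iff hp hU s _).1 ((hasDirections_iff_heckeMap hp hU s _).2 h)
  have h2 := (hasDirections_iff hp hU s' _).1 ((hasDirections_iff_heckeMap hp hU s' _).2 rfl)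
  exact Quotient.sound (equivalent_of_range_eq s s' hp fun i => (h1 i).trans (h2 i).symm)

end HeckeSequence

/-! ### Morphisms between split bundles -/

theorem CP1.idx_eq_zero {x : CP1} (hx : x ∈ CP1.U 0) : CP1.idx x = 0 := if_pos hx

theorem CP1.idx_eq_one {x : CP1} (hx : x ∉ CP1.U 0) : CP1.idx x = 1 := if_neg hx

theorem CP1.ξ_eq_zero {i : Fin 2} {x : CP1} (hx : x ∉ CP1.U (1 - i)) : CP1.ξ i x = 0 := by
  induction x using Projectivization.ind with
  | h v hv =>
    rw [CP1.mk_mem_U, not_not] at hx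
    rw [CP1.ξ_mk, hx, zero_div]

/-- The matrix of the morphism `A + z B` between split bundles in the frames over `U i`; the
integer `m k l` is the degree of the line bundle `Hom(𝒪(d' l), 𝒪(d k))`. -/
def affineMatrix (m : Fin 2 → Fin 2 → ℤ) (A B : Matrix (Fin 2) (Fin 2) ℂ) (i : Fin 2) (x : CP1) :
    Matrix (Fin 2) (Fin 2) ℂ :=
  Matrix.of fun k l => if i = 0 then A k l + B k l * CP1.ξ 0 x else
    A k l * CP1.ξ 1 x ^ (m k l).toNat + B k l * CP1.ξ 1 x ^ (m k l - 1).toNat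

section affine

variable {a b a' b' : ℤ} {A B : Matrix (Fin 2) (Fin 2) ℂ}

/-- With `w = 1 / z`, an entry of degree `m` is multiplied by `w ^ m`, so `A + B z` becomes `A w ^ m
+ B w ^ (m - 1)`. By `hA` and `hB` the exponents of nonzero terms are nonnegative, so `toNat`
truncates none of them. -/
theorem affineMatrix_transition {d d' : Fin 2 → ℤ}
    (hA : ∀ k l, A k l ≠ 0 → d' l ≤ d k) (hB : ∀ k l, B k l ≠ 0 → d' l + 1 ≤ d k) (i : Fin 2)
    {x : CP1} (hx : x ∈ CP1.U i) (k l : Fin 2) :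
    transition (CP1.idx x) i x ^ d k *
        affineMatrix (fun k l => d k - d' l) A B (CP1.idx x) x k l =
      affineMatrix (fun k l => d k - d' l) A B i x k l * transition (CP1.idx x) i x ^ d' l := by
  -- `idx` prefers the patch `U 0`, so the only nontrivial change of frame is from `0` to `1`.
  by_cases hi : CP1.idx x = i
  · rw [hi]
    simp [transition]
  have h0 : x ∈ CP1.U 0 := by
    by_contra h
    refine hi ((CP1.idx_eq_one h).trans ?_)
    fin_cases i
    · exact absurd hx h
    · rfl
  have hi1 : i = 1 := by
    rw [CP1.idx_eq_zero h0] at hi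
    fin_cases i
    · exact absurd rfl hi
    · rfl
  subst hi1
  rw [CP1.idx_eq_zero h0]
  have hw : CP1.ξ 1 x ≠ 0 := CP1.ξ_ne_zero (by decide) hx h0
  have hz : CP1.ξ 0 x = (CP1.ξ 1 x)⁻¹ := CP1.ξ_inv (by decide) x
  simp only [transition, zero_ne_one, if_false, affineMatrix, Matrix.of_apply, if_true, hz,
    one_ne_zero]
  rw [mul_add, add_mul]
  congr 1
  · by_cases h : A k l = 0
    · simp [h]
    · have h1 : CP1.ξ 1 x ^ (d k - d' l).toNat = CP1.ξ 1 x ^ (d k - d' l) := by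
        rw [← zpow_natCast, Int.toNat_of_nonneg (by have := hA k l h; omega)]
      rw [h1, mul_assoc, ← zpow_add₀ hw, sub_add_cancel, mul_comm]
  · by_cases h : B k l = 0
    · simp [h]
    · have h1 : CP1.ξ 1 x ^ (d k - d' l - 1).toNat = CP1.ξ 1 x ^ (d k - d' l - 1) := by
        rw [← zpow_natCast, Int.toNat_of_nonneg (by have := hB k l h; omega)]
      rw [h1, mul_assoc, ← zpow_add₀ hw, mul_left_comm, ← zpow_sub_one₀ hw]
      congr 2
      ring

theorem contMDiffAt_affineMatrix (m : Fin 2 → Fin 2 → ℤ) (i : Fin 2) {x : CP1}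
    (hx : x ∈ CP1.U i) (k l : Fin 2) :
    ContMDiffAt 𝓘(ℂ, ℂ) 𝓘(ℂ, ℂ) ω (fun y => affineMatrix m A B i y k l) x := by
  have h := (contMDiffOn_ξ i).contMDiffAt ((CP1.isOpen_U i).mem_nhds hx)
  fin_cases i
  · exact contMDiffAt_const.add (contMDiffAt_const.mul h)
  · exact (contMDiffAt_const.mul (h.pow _)).add (contMDiffAt_const.mul (h.pow _))

/-- The degrees of the line bundles `Hom(𝒪(d' l), 𝒪(d k))`. -/
def homDegree (d' d : Fin 2 → ℤ) (k l : Fin 2) : ℤ := d k - d' l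

/-- The maps on the fibers given by `affineMatrix`. -/
def affineFamily (a' b' a b : ℤ) (A B : Matrix (Fin 2) (Fin 2) ℂ) (x : CP1) :
    (splitBundle a' b').fiber x →ₗ[ℂ] (splitBundle a b).fiber x :=
  show (Fin 2 → ℂ) →ₗ[ℂ] (Fin 2 → ℂ) from
    Matrix.toLin' (affineMatrix (homDegree ![a', b'] ![a, b]) A B (CP1.idx x) x)

theorem affineFamily_apply (x : CP1) (v : Fin 2 → ℂ) :
    (affineFamily a' b' a b A B x v : Fin 2 → ℂ) =
      (affineMatrix (homDegree ![a', b'] ![a, b]) A B (CP1.idx x) x).mulVec v := rfl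

/-- The fiber over `x` is `ℂ²` in the preferred frame `idx x`, where the family is defined; here its
formula is extended to both frames. -/
theorem frame_affineFamily
    (hA : ∀ k l, A k l ≠ 0 → (![a', b'] : Fin 2 → ℤ) l ≤ (![a, b] : Fin 2 → ℤ) k)
    (hB : ∀ k l, B k l ≠ 0 → (![a', b'] : Fin 2 → ℤ) l + 1 ≤ (![a, b] : Fin 2 → ℤ) k) {i : Fin 2}
    {x : CP1} (hx : x ∈ CP1.U i) (v : (splitBundle a' b').fiber x) :
    (frame a b i ⟨x, affineFamily a' b' a b A B x v⟩).2 =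
      (affineMatrix (homDegree ![a', b'] ![a, b]) A B i x).mulVec (frame a' b' i ⟨x, v⟩).2 := by
  ext k
  rw [frame_apply]
  change _ * ((affineMatrix (homDegree ![a', b'] ![a, b]) A B (CP1.idx x) x).mulVec v) k = _
  simp only [Matrix.mulVec, dotProduct, Finset.mul_sum]
  refine Finset.sum_congr rfl fun l _ => ?_
  rw [← mul_assoc, frame_apply, ← mul_assoc]
  congr 1
  exact affineMatrix_transition hA hB i hx k l

/-- The morphism of split bundles with matrix `A + z B` in the frames over `U 0`. -/
def affineHom (a' b' a b : ℤ) (A B : Matrix (Fin 2) (Fin 2) ℂ)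
    (hA : ∀ k l, A k l ≠ 0 → (![a', b'] : Fin 2 → ℤ) l ≤ (![a, b] : Fin 2 → ℤ) k)
    (hB : ∀ k l, B k l ≠ 0 → (![a', b'] : Fin 2 → ℤ) l + 1 ≤ (![a, b] : Fin 2 → ℤ) k) :
    Hom (splitBundle a' b') (splitBundle a b) where
  toFun := affineFamily a' b' a b A B
  contMDiff := by
    rintro ⟨x, v⟩
    have hx := CP1.mem_U_idx x
    refine contMDiffAt_of_coords (affineFamily a' b' a b A B) (isHolomorphicTriv_frame a' b' _)
      (isHolomorphicTriv_frame a b _) (mem_frame_baseSet.2 hx) (mem_frame_baseSet.2 hx)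
      (M := fun y => LinearMap.toContinuousLinearMap (Matrix.toLin'
        (affineMatrix (homDegree ![a', b'] ![a, b]) A B (CP1.idx x) y))) ?_ ?_ v
    · refine contMDiffAt_clm_of_entries fun v k => ?_
      simp only [LinearMap.coe_toContinuousLinearMap', Matrix.toLin'_apply, Matrix.mulVec,
        dotProduct]
      exact contMDiffAt_finsetSum fun l _ =>
        (contMDiffAt_affineMatrix _ _ hx k l).mul contMDiffAt_const
    · filter_upwards [(CP1.isOpen_U _).mem_nhds hx] with y hy w
      exact frame_affineFamily hA hB hy w

end affine

/-! ### Hecke modifications of split bundles -/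

theorem contMDiff_id_prod (A : (Fin 2 → ℂ) →L[ℂ] (Fin 2 → ℂ)) :
    ContMDiff (𝓘(ℂ, ℂ).prod 𝓘(ℂ, Fin 2 → ℂ)) (𝓘(ℂ, ℂ).prod 𝓘(ℂ, Fin 2 → ℂ)) ω
      (fun y : CP1 × (Fin 2 → ℂ) => (y.1, A y.2)) :=
  contMDiff_fst.prodMk (A.contMDiff.comp contMDiff_snd)

/-- A constant change of frame is holomorphic. -/
theorem RankTwoBundle.IsHolomorphicTriv.trans {E : RankTwoBundle} {e : E.Triv}
    (he : IsHolomorphicTriv e) (A : (Fin 2 → ℂ) ≃L[ℂ] (Fin 2 → ℂ)) :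
    IsHolomorphicTriv (e.transFiberHomeomorph A.toHomeomorph) where
  linear := ⟨fun b hb => by
    have h := he.linear.linear b hb
    exact ⟨fun v w => (congrArg A (h.map_add v w)).trans (map_add A _ _),
      fun c v => (congrArg A (h.map_smul c v)).trans (map_smul A _ _)⟩⟩
  contMDiffOn := (contMDiff_id_prod (A : (Fin 2 → ℂ) →L[ℂ] (Fin 2 → ℂ))).comp_contMDiffOn
    he.contMDiffOn
  contMDiffOn_symm := by
    refine he.contMDiffOn_symm.comp
      (contMDiff_id_prod (A.symm : (Fin 2 → ℂ) →L[ℂ] (Fin 2 → ℂ))).contMDiffOn fun y hy => ?_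
    rw [Trivialization.mem_target] at hy
    exact (e.mem_target).2 hy

/-- A morphism of split bundles that has the matrix `S⁻¹ diag(1, z - μ) T` over `U 0` and is
bijective away from `z = μ` is a Hecke modification. -/
def splitModification {a' b' a b : ℤ} (f : Hom (splitBundle a' b') (splitBundle a b)) {p : CP1}
    (hp : p ∈ CP1.U 0) (hf : ∀ q, q ≠ p → Function.Bijective (f.toFun q))
    (S T : (Fin 2 → ℂ) ≃L[ℂ] (Fin 2 → ℂ))
    (h : ∀ q ∈ CP1.U 0, ∀ v, S (frame a b 0 ⟨q, f.toFun q v⟩).2 =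
      Matrix.mulVec !![1, 0; 0, CP1.ξ 0 q - CP1.ξ 0 p] (T (frame a' b' 0 ⟨q, v⟩).2)) :
    HeckeModification (splitBundle a b) (splitBundle a' b') p where
  hom := f
  bijective := hf
  local_form := ⟨CP1.chart 0, (frame a b 0).transFiberHomeomorph S.toHomeomorph,
    (frame a' b' 0).transFiberHomeomorph T.toHomeomorph,
    IsManifold.subset_maximalAtlas (mem_range_self 0), hp,
    (isHolomorphicTriv_frame a b 0).trans S, fun _ hx => hx,
    (isHolomorphicTriv_frame a' b' 0).trans T, fun _ hx => hx, h⟩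

theorem bijective_affineFamily {a' b' a b : ℤ} {A B : Matrix (Fin 2) (Fin 2) ℂ} {x : CP1}
    (h : (affineMatrix (homDegree ![a', b'] ![a, b]) A B (CP1.idx x) x).det ≠ 0) :
    Function.Bijective (affineFamily a' b' a b A B x) :=
  ⟨Matrix.mulVec_injective_iff_isUnit.2 ((Matrix.isUnit_iff_isUnit_det _).2 h.isUnit),
    Matrix.mulVec_surjective_iff_isUnit.2 ((Matrix.isUnit_iff_isUnit_det _).2 h.isUnit)⟩

/-- Take the matrix with rows `(z - μ, c)` and `(0, 1)`: its determinant vanishes only at `p`, where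
the image is spanned by `(c, 1)`. The entry `c` is a map `𝒪(b) → 𝒪(a)`, whence the condition `b ≤ a`
when `c ≠ 0`. -/
theorem exists_splitModification_left (a b : ℤ) {p : CP1} (hp : p ∈ CP1.U 0) (c : ℂ)
    (hc : c ≠ 0 → b ≤ a) :
    ∃ α : HeckeModification (splitBundle a b) (splitBundle (a - 1) b) p,
      (range (α.hom.toFun p) : Set (Fin 2 → ℂ)) = Submodule.span ℂ {![c, 1]} := by
  let A : Matrix (Fin 2) (Fin 2) ℂ := !![-CP1.ξ 0 p, c; 0, 1]
  let B : Matrix (Fin 2) (Fin 2) ℂ := !![1, 0; 0, 0]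
  have hA : ∀ k l, A k l ≠ 0 → (![a - 1, b] : Fin 2 → ℤ) l ≤ (![a, b] : Fin 2 → ℤ) k := by
    intro k l
    fin_cases k <;> fin_cases l <;> simp [A]
    exact hc
  have hB : ∀ k l, B k l ≠ 0 → (![a - 1, b] : Fin 2 → ℤ) l + 1 ≤ (![a, b] : Fin 2 → ℤ) k := by
    intro k l
    fin_cases k <;> fin_cases l <;> simp [B]
  have h0 : ∀ q, affineMatrix (homDegree ![a - 1, b] ![a, b]) A B 0 q =
      !![CP1.ξ 0 q - CP1.ξ 0 p, c; 0, 1] := by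
    intro q
    ext k l
    fin_cases k <;> fin_cases l <;> simp [affineMatrix, A, B]
    ring
  -- `S` acts by the second matrix given and sends `(c, 1)` to `(1, 0)`; `T` swaps the coordinates.
  let S : (Fin 2 → ℂ) ≃L[ℂ] (Fin 2 → ℂ) := (Matrix.toLin'OfInv (M := !![c, 1; 1, 0])
    (M' := !![0, 1; 1, -c]) (by ext i j; fin_cases i <;> fin_cases j <;> simp)
    (by ext i j; fin_cases i <;> fin_cases j <;> simp)).toContinuousLinearEquiv
  let T : (Fin 2 → ℂ) ≃L[ℂ] (Fin 2 → ℂ) := (Matrix.toLin'OfInv (M := !![0, 1; 1, 0])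
    (M' := !![0, 1; 1, (0 : ℂ)]) (by ext i j; fin_cases i <;> fin_cases j <;> simp)
    (by ext i j; fin_cases i <;> fin_cases j <;> simp)).toContinuousLinearEquiv
  refine ⟨splitModification (affineHom _ _ _ _ A B hA hB) hp (fun q hq => ?_) S T ?_, ?_⟩
  · refine bijective_affineFamily ?_
    by_cases h : q ∈ CP1.U 0
    · rw [CP1.idx_eq_zero h, h0, Matrix.det_fin_two_of, mul_one, mul_zero, sub_zero, sub_ne_zero]
      exact fun h1 => hq ((CP1.chart 0).injOn h hp h1)
    · rw [CP1.idx_eq_one h, Matrix.det_fin_two]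
      simp [affineMatrix, A, B, homDegree, CP1.ξ_eq_zero (i := 1) (x := q) h]
  · intro q hq v
    have h1 := frame_affineFamily hA hB hq v
    rw [h0] at h1
    refine (congrArg S h1).trans ?_
    change Matrix.mulVec !![0, 1; 1, -c] (Matrix.mulVec _ _) =
      Matrix.mulVec _ (Matrix.mulVec !![0, 1; 1, 0] _)
    rw [Matrix.mulVec_mulVec, Matrix.mulVec_mulVec]
    congr 1
    ext i j
    fin_cases i <;> fin_cases j <;> simp
  · have h1 : ∀ v : Fin 2 → ℂ,
        (affineFamily (a - 1) b a b A B p v : Fin 2 → ℂ) = v 1 • ![c, 1] := by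
      intro v
      rw [affineFamily_apply, CP1.idx_eq_zero hp, h0]
      refine funext fun i : Fin 2 => ?_
      fin_cases i <;> simp [Matrix.mulVec, dotProduct, Fin.sum_univ_two, mul_comm]
    ext w
    rw [SetLike.mem_coe, Submodule.mem_span_singleton]
    constructor
    · rintro ⟨v, rfl⟩
      exact ⟨_, (h1 v).symm⟩
    · rintro ⟨t, rfl⟩
      exact ⟨fun _ => t, h1 _⟩

/-- The mirror image: rows `(1, 0)` and `(c, z - μ)`, with `c` a map `𝒪(a) → 𝒪(b)`. -/
theorem exists_splitModification_right (a b : ℤ) {p : CP1} (hp : p ∈ CP1.U 0) (c : ℂ)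
    (hc : c ≠ 0 → a ≤ b) :
    ∃ α : HeckeModification (splitBundle a b) (splitBundle a (b - 1)) p,
      (range (α.hom.toFun p) : Set (Fin 2 → ℂ)) = Submodule.span ℂ {![1, c]} := by
  let A : Matrix (Fin 2) (Fin 2) ℂ := !![1, 0; c, -CP1.ξ 0 p]
  let B : Matrix (Fin 2) (Fin 2) ℂ := !![0, 0; 0, 1]
  have hA : ∀ k l, A k l ≠ 0 → (![a, b - 1] : Fin 2 → ℤ) l ≤ (![a, b] : Fin 2 → ℤ) k := by
    intro k l
    fin_cases k <;> fin_cases l <;> simp [A]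
    exact hc
  have hB : ∀ k l, B k l ≠ 0 → (![a, b - 1] : Fin 2 → ℤ) l + 1 ≤ (![a, b] : Fin 2 → ℤ) k := by
    intro k l
    fin_cases k <;> fin_cases l <;> simp [B]
  have h0 : ∀ q, affineMatrix (homDegree ![a, b - 1] ![a, b]) A B 0 q =
      !![1, 0; c, CP1.ξ 0 q - CP1.ξ 0 p] := by
    intro q
    ext k l
    fin_cases k <;> fin_cases l <;> simp [affineMatrix, A, B]
    ring
  let S : (Fin 2 → ℂ) ≃L[ℂ] (Fin 2 → ℂ) := (Matrix.toLin'OfInv (M := !![1, 0; c, 1])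
    (M' := !![1, 0; -c, 1]) (by ext i j; fin_cases i <;> fin_cases j <;> simp)
    (by ext i j; fin_cases i <;> fin_cases j <;> simp)).toContinuousLinearEquiv
  refine ⟨splitModification (affineHom _ _ _ _ A B hA hB) hp (fun q hq => ?_) S
    (ContinuousLinearEquiv.refl ℂ _) ?_, ?_⟩
  · refine bijective_affineFamily ?_
    by_cases h : q ∈ CP1.U 0
    · rw [CP1.idx_eq_zero h, h0, Matrix.det_fin_two_of, one_mul, zero_mul, sub_zero, sub_ne_zero]
      exact fun h1 => hq ((CP1.chart 0).injOn h hp h1)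
    · rw [CP1.idx_eq_one h, Matrix.det_fin_two]
      simp [affineMatrix, A, B, homDegree, CP1.ξ_eq_zero (i := 1) (x := q) h]
  · intro q hq v
    have h1 := frame_affineFamily hA hB hq v
    rw [h0] at h1
    refine (congrArg S h1).trans ?_
    change Matrix.mulVec !![1, 0; -c, 1] (Matrix.mulVec _ _) = Matrix.mulVec _ _
    rw [Matrix.mulVec_mulVec]
    congr 1
    ext i j
    fin_cases i <;> fin_cases j <;> simp
  · have h1 : ∀ v : Fin 2 → ℂ,
        (affineFamily a (b - 1) a b A B p v : Fin 2 → ℂ) = v 0 • ![1, c] := by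
      intro v
      rw [affineFamily_apply, CP1.idx_eq_zero hp, h0]
      refine funext fun i : Fin 2 => ?_
      fin_cases i <;> simp [Matrix.mulVec, dotProduct, Fin.sum_univ_two, mul_comm]
    ext w
    rw [SetLike.mem_coe, Submodule.mem_span_singleton]
    constructor
    · rintro ⟨v, rfl⟩
      exact ⟨_, (h1 v).symm⟩
    · rintro ⟨t, rfl⟩
      exact ⟨fun _ => t, h1 _⟩

/-- Every line in a fiber of a split bundle is the image of a Hecke modification from a split
bundle of degree one less. -/
theorem exists_splitModification (a b : ℤ) {p : CP1} (hp : p ∈ CP1.U 0) {u : Fin 2 → ℂ}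
    (hu : u ≠ 0) : ∃ a' b' : ℤ, a' + b' = a + b - 1 ∧
      ∃ α : HeckeModification (splitBundle a b) (splitBundle a' b') p,
        (range (α.hom.toFun p) : Set (Fin 2 → ℂ)) = Submodule.span ℂ {u} := by
  have hspan : ∀ (t : ℂ) (w : Fin 2 → ℂ), t ≠ 0 → u = t • w →
      Submodule.span ℂ {w} = Submodule.span ℂ {u} := fun t w ht h => by
    rw [h, Submodule.span_singleton_smul_eq ht.isUnit]
  -- A line off both axes is reached by a nonzero off-diagonal constant, which must map the summand
  -- of smaller degree to that of larger degree; this decides which summand is lowered.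
  by_cases h0 : u 1 ≠ 0 ∧ (u 0 / u 1 ≠ 0 → b ≤ a)
  · obtain ⟨α, hα⟩ := exists_splitModification_left a b hp (u 0 / u 1) h0.2
    refine ⟨a - 1, b, by ring, α, hα.trans ?_⟩
    rw [hspan (u 1) _ h0.1]
    ext i
    fin_cases i
    · simp [mul_div_cancel₀ _ h0.1]
    · simp
  · have h1 : u 0 ≠ 0 ∧ (u 1 / u 0 ≠ 0 → a ≤ b) := by
      by_cases h1 : u 1 = 0
      · refine ⟨fun h2 => hu ?_, fun h2 => absurd (by simp [h1]) h2⟩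
        ext i
        fin_cases i
        · exact h2
        · exact h1
      · rw [not_and, Classical.not_imp] at h0
        obtain ⟨h2, h3⟩ := h0 h1
        exact ⟨fun h4 => h2 (by simp [h4]), fun _ => (not_le.1 h3).le⟩
    obtain ⟨α, hα⟩ := exists_splitModification_right a b hp (u 1 / u 0) h1.2
    refine ⟨a, b - 1, by ring, α, hα.trans ?_⟩
    rw [hspan (u 0) _ h1.1]
    ext i
    fin_cases i
    · simp
    · simp [mul_div_cancel₀ _ h1.1]

/-- Every family of lines in the fibers of a split bundle over distinct points comes from a sequence
of Hecke modifications whose terminal bundle is split. -/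
theorem exists_heckeSequence {n : ℕ} (a b : ℤ) (p : Fin n → CP1) (hp : Function.Injective p)
    (hU : ∀ i, p i ∈ CP1.U 0) (u : Fin n → Fin 2 → ℂ) (hu : ∀ i, u i ≠ 0) :
    ∃ s : HeckeSequence (splitBundle a b) p,
      (∃ a' b' : ℤ, a' + b' = a + b - n ∧ s.terminal = splitBundle a' b') ∧
      ∀ i, (range ((s.compHom i.succ).toFun (p i)) : Set (Fin 2 → ℂ)) =
        Submodule.span ℂ {u i} := by
  induction n generalizing a b with
  | zero => exact ⟨⟨Fin.elim0, fun i => i.elim0⟩, ⟨a, b, by simp, rfl⟩, fun i => i.elim0⟩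
  | succ n ih =>
    obtain ⟨a', b', hab, α, hα⟩ := exists_splitModification a b (hU 0) (hu 0)
    have h1 : ∀ i : Fin n, Function.Bijective (α.hom.toFun (p i.succ)) := fun i =>
      α.bijective _ fun h => Fin.succ_ne_zero i (hp h)
    -- The remaining lines are pulled back through `α`, an isomorphism at the other points, and the
    -- induction continues on the new split bundle.
    obtain ⟨u', hu'⟩ : ∃ u' : Fin n → Fin 2 → ℂ, ∀ i,
        α.hom.toFun (p i.succ) (show (splitBundle a' b').fiber _ from u' i) =
          (show (splitBundle a b).fiber _ from u i.succ) :=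
      ⟨fun i => ((h1 i).2 (show (splitBundle a b).fiber _ from u i.succ)).choose,
        fun i => ((h1 i).2 (show (splitBundle a b).fiber _ from u i.succ)).choose_spec⟩
    obtain ⟨s, ⟨a'', b'', hab', hs⟩, hsu⟩ := ih a' b' (fun i => p i.succ)
      (hp.comp (Fin.succ_injective _)) (fun i => hU _) u' (fun i h => hu i.succ (by
        have h2 := hu' i
        rw [show u' i = (0 : (splitBundle a' b').fiber (p i.succ)) from h, map_zero] at h2
        exact h2.symm))
    refine ⟨HeckeSequence.cons α s, ⟨a'', b'', ?_, ?_⟩, fun i => ?_⟩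
    · push_cast
      omega
    · rw [HeckeSequence.terminal_cons, hs]
    · rw [HeckeSequence.compHom_cons]
      cases i using Fin.cases with
      | zero =>
        exact hα
      | succ i =>
        have h2 : ∀ t : ℂ, α.hom.toFun (p i.succ) (t • u' i) =
            (show (splitBundle a b).fiber _ from t • u i.succ) := fun t => by
          exact (map_smul (α.hom.toFun (p i.succ)) t _).trans (congrArg (t • ·) (hu' i))
        ext w
        rw [SetLike.mem_coe, Submodule.mem_span_singleton]
        constructor
        · rintro ⟨v, rfl⟩
          obtain ⟨t, ht⟩ : ∃ t : ℂ, t • u' i =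
              (show Fin 2 → ℂ from (s.compHom i.succ).toFun (p i.succ) v) :=
            Submodule.mem_span_singleton.1 ((hsu i).subset ⟨v, rfl⟩)
          refine ⟨t, (h2 t).symm.trans ?_⟩
          exact congrArg (α.hom.toFun (p i.succ)) ht
        · rintro ⟨t, rfl⟩
          have h3 : t • u' i ∈
              (range ((s.compHom i.succ).toFun (p i.succ)) : Set (Fin 2 → ℂ)) := by
            rw [hsu i]
            exact Submodule.mem_span_singleton.2 ⟨t, rfl⟩
          obtain ⟨v, hv⟩ := h3
          refine ⟨v, Eq.trans ?_ (h2 t)⟩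
          exact congrArg (α.hom.toFun (p i.succ)) hv

/-! ### Morphisms of split bundles and degrees -/

theorem frame_apply_of_mem {a b : ℤ} {x : CP1} (hx : x ∈ CP1.U 0)
    (v : (splitBundle a b).fiber x) : (frame a b 0 ⟨x, v⟩).2 = (show Fin 2 → ℂ from v) := by
  ext k
  rw [frame_apply, CP1.idx_eq_zero hx]
  simp [transition]

section split

variable {a b a' b' : ℤ}

/-- The matrix of a morphism of split bundles in the frames over `U i`. -/
def splitCoords (f : Hom (splitBundle a' b') (splitBundle a b)) (i : Fin 2) (x : CP1) :
    (Fin 2 → ℂ) →L[ℂ] (Fin 2 → ℂ) :=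
  coords f.toFun (frame a' b' i) (frame a b i) x

theorem splitCoords_zero_apply (f : Hom (splitBundle a' b') (splitBundle a b)) {x : CP1}
    (hx : x ∈ CP1.U 0) (v : Fin 2 → ℂ) :
    splitCoords f 0 x v = (f.toFun x v : Fin 2 → ℂ) := by
  exact (congrArg (splitCoords f 0 x) (frame_apply_of_mem hx v).symm).trans
    ((coords_apply f.toFun (frame a' b' 0) (frame a b 0) (mem_frame_baseSet.2 hx)
      (mem_frame_baseSet.2 hx) v).trans (frame_apply_of_mem hx _))

theorem analyticAt_splitCoords (f : Hom (splitBundle a' b') (splitBundle a b)) (i k : Fin 2)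
    (v : Fin 2 → ℂ) (z : ℂ) : AnalyticAt ℂ (fun z => splitCoords f i (CP1.pt i z) v k) z :=
  analyticAt_comp_pt (g := fun x => splitCoords f i x v k) (contMDiffAt_apply
    (contMDiffAt_coords f (isHolomorphicTriv_frame a' b' i) (isHolomorphicTriv_frame a b i)
    (mem_frame_baseSet.2 (CP1.pt_mem_U i z)) (mem_frame_baseSet.2 (CP1.pt_mem_U i z))) v k)

theorem splitCoords_transition (f : Hom (splitBundle a' b') (splitBundle a b)) {x : CP1}
    (h0 : x ∈ CP1.U 0) (h1 : x ∈ CP1.U 1) (k l : Fin 2) :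
    CP1.ξ 1 x ^ (![a', b'] : Fin 2 → ℤ) l * splitCoords f 1 x (Pi.single l 1) k =
      CP1.ξ 1 x ^ (![a, b] : Fin 2 → ℤ) k * splitCoords f 0 x (Pi.single l 1) k := by
  have hT : ∀ (c d : ℤ) (v : (splitBundle c d).fiber x) (k : Fin 2), (frame c d 1 ⟨x, v⟩).2 k =
      CP1.ξ 1 x ^ (![c, d] : Fin 2 → ℤ) k * (show Fin 2 → ℂ from v) k := fun c d v k => by
    rw [frame_apply, CP1.idx_eq_zero h0]
    rfl
  let e : (splitBundle a' b').fiber x := (Pi.single l 1 : Fin 2 → ℂ)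
  have h2 := coords_apply f.toFun (frame a' b' 1) (frame a b 1) (mem_frame_baseSet.2 h1)
    (mem_frame_baseSet.2 h1) e
  have h3 : (frame a' b' 1 ⟨x, e⟩).2 =
      CP1.ξ 1 x ^ (![a', b'] : Fin 2 → ℤ) l • (Pi.single l 1 : Fin 2 → ℂ) := by
    ext j
    rw [hT, Pi.smul_apply, smul_eq_mul]
    by_cases hj : j = l
    · rw [hj]
    · change _ * (Pi.single l 1 : Fin 2 → ℂ) j = _
      rw [Pi.single_eq_of_ne hj, mul_zero, mul_zero]
  rw [h3, map_smul] at h2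
  have h4 := congrFun h2 k
  rw [hT] at h4
  rw [splitCoords_zero_apply f h0]
  exact h4

/-- The entries of nonpositive degree of a morphism of split bundles are constant. -/
theorem splitCoords_eq (f : Hom (splitBundle a' b') (splitBundle a b)) (k l : Fin 2)
    (hkl : (![a, b] : Fin 2 → ℤ) k ≤ (![a', b'] : Fin 2 → ℤ) l) {x : CP1} (hx : x ∈ CP1.U 0) :
    splitCoords f 0 x (Pi.single l 1) k =
      0 ^ ((![a', b'] : Fin 2 → ℤ) l - (![a, b] : Fin 2 → ℤ) k).toNat *
        splitCoords f 1 (CP1.pt 1 0) (Pi.single l 1) k := by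
  -- The factor `0 ^ m` treats two cases at once: `1` for degree zero (the entry is constant), `0`
  -- for negative degree (it vanishes).
  set m := ((![a', b'] : Fin 2 → ℤ) l - (![a, b] : Fin 2 → ℤ) k).toNat with hm
  have hd : Differentiable ℂ (fun z => splitCoords f 0 (CP1.pt 0 z) (Pi.single l 1) k) :=
    fun z => (analyticAt_splitCoords f 0 k _ z).differentiableAt
  have hc : Filter.Tendsto (fun w : ℂ => w ^ m * splitCoords f 1 (CP1.pt 1 w) (Pi.single l 1) k)
      (𝓝 0) (𝓝 (0 ^ m * splitCoords f 1 (CP1.pt 1 0) (Pi.single l 1) k)) :=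
    ((continuousAt_id.pow m).mul (analyticAt_splitCoords f 1 k _ 0).continuousAt).tendsto
  have hinv : Filter.Tendsto (fun z : ℂ => z⁻¹) (Filter.cocompact ℂ) (𝓝 0) :=
    Metric.cobounded_eq_cocompact (α := ℂ) ▸ Filter.tendsto_inv₀_cobounded
  -- At infinity the entry equals `w ^ m` times the entry in the other frame, `w = 1 / z`. So it is
  -- an entire function with a finite limit, and Liouville applies.
  have h1 : Filter.Tendsto (fun z => splitCoords f 0 (CP1.pt 0 z) (Pi.single l 1) k)
      (Filter.cocompact ℂ) (𝓝 (0 ^ m * splitCoords f 1 (CP1.pt 1 0) (Pi.single l 1) k)) := by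
    refine (hc.comp hinv).congr' ?_
    rw [← Metric.cobounded_eq_cocompact]
    filter_upwards [Bornology.eventually_ne_cobounded (0 : ℂ)] with z hz
    have h0 := CP1.pt_mem_U 0 z
    have h1 : CP1.pt 0 z ∈ CP1.U 1 := by
      rw [CP1.pt, CP1.mk_mem_U]
      simpa [CP1.vec] using hz
    have hξ : CP1.ξ 1 (CP1.pt 0 z) = z⁻¹ := by
      rw [CP1.ξ_inv (i := 0) (by decide), CP1.ξ_pt]
    have hpt : CP1.pt 1 z⁻¹ = CP1.pt 0 z := by
      rw [← hξ, CP1.pt_ξ 1 _ h1]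
    have h2 := splitCoords_transition f h0 h1 k l
    rw [hξ] at h2
    simp only [Function.comp, hpt]
    have hz' : z⁻¹ ≠ 0 := inv_ne_zero hz
    have h3 : z⁻¹ ^ m * z⁻¹ ^ (![a, b] : Fin 2 → ℤ) k = z⁻¹ ^ (![a', b'] : Fin 2 → ℤ) l := by
      rw [← zpow_natCast, ← zpow_add₀ hz', hm, Int.toNat_of_nonneg (sub_nonneg.2 hkl),
        sub_add_cancel]
    apply mul_left_cancel₀ (zpow_ne_zero ((![a, b] : Fin 2 → ℤ) k) hz')
    rw [← h2, ← h3]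
    ring
  have h2 := hd.apply_eq_of_tendsto_cocompact (CP1.ξ 0 x) h1
  rwa [CP1.pt_ξ 0 x hx] at h2

theorem splitCoords_eq_zero (f : Hom (splitBundle a' b') (splitBundle a b)) (k l : Fin 2)
    (hkl : (![a, b] : Fin 2 → ℤ) k < (![a', b'] : Fin 2 → ℤ) l) {x : CP1} (hx : x ∈ CP1.U 0) :
    splitCoords f 0 x (Pi.single l 1) k = 0 := by
  rw [splitCoords_eq f k l hkl.le hx, zero_pow, zero_mul]
  omega

/-- Otherwise column `l` has only entries of negative degree and is zero. -/
theorem exists_le_of_injective (f : Hom (splitBundle a' b') (splitBundle a b)) {x : CP1}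
    (hx : x ∈ CP1.U 0) (hf : Function.Injective (f.toFun x)) (l : Fin 2) :
    ∃ k, (![a', b'] : Fin 2 → ℤ) l ≤ (![a, b] : Fin 2 → ℤ) k := by
  by_contra! h
  have h1 : splitCoords f 0 x (Pi.single l 1) = 0 :=
    funext fun k => splitCoords_eq_zero f k l (h k) hx
  rw [splitCoords_zero_apply f hx] at h1
  have h2 : (Pi.single l 1 : Fin 2 → ℂ) = 0 := hf (h1.trans (map_zero (f.toFun x)).symm)
  have h3 := congrFun h2 l
  simp at h3

/-- Otherwise row `k` has only entries of negative degree and is zero. -/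
theorem exists_le_of_surjective (f : Hom (splitBundle a' b') (splitBundle a b)) {x : CP1}
    (hx : x ∈ CP1.U 0) (hf : Function.Surjective (f.toFun x)) (k : Fin 2) :
    ∃ l, (![a', b'] : Fin 2 → ℤ) l ≤ (![a, b] : Fin 2 → ℤ) k := by
  by_contra! h
  obtain ⟨v, hv⟩ : ∃ v : Fin 2 → ℂ, (f.toFun x v : Fin 2 → ℂ) = Pi.single k 1 := hf _
  have h1 : splitCoords f 0 x v k = 1 := by
    rw [splitCoords_zero_apply f hx]
    exact (congrFun hv k).trans (Pi.single_eq_same _ _)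
  rw [pi_eq_sum_univ' v] at h1
  simp [Fin.sum_univ_two, splitCoords_eq_zero f k _ (h _) hx] at h1

end split

theorem RankTwoBundle.Iso.bijective {E F : RankTwoBundle} (φ : Iso E F) (x : CP1) :
    Function.Bijective (φ.hom.toFun x) := by
  refine Function.bijective_iff_has_inverse.2 ⟨φ.inv.toFun x, fun v => ?_, fun v => ?_⟩
  · exact congrArg (fun k : Hom E E => k.toFun x v) φ.hom_inv
  · exact congrArg (fun k : Hom F F => k.toFun x v) φ.inv_hom

/-- The Hecke length of a split bundle is an isomorphism invariant. -/
theorem abs_sub_eq_of_iso {a b c d : ℤ} (φ : Iso (splitBundle a b) (splitBundle c d)) :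
    |a - b| = |c - d| := by
  have hx := CP1.pt_mem_U 0 0
  -- Injectivity compares the larger degrees and surjectivity the smaller ones; with the inverse
  -- isomorphism both must be equal.
  have h1 := exists_le_of_injective φ.hom hx (φ.bijective _).1
  have h2 := exists_le_of_surjective φ.hom hx (φ.bijective _).2
  have h3 := exists_le_of_injective φ.symm.hom hx (φ.symm.bijective _).1
  have h4 := exists_le_of_surjective φ.symm.hom hx (φ.symm.bijective _).2
  simp only [Fin.forall_fin_two, Fin.exists_fin_two, Matrix.cons_val_zero,
    Matrix.cons_val_one] at h1 h2 h3 h4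
  rcases abs_cases (a - b) with h | h <;> rcases abs_cases (c - d) with h' | h' <;> omega

theorem hasHeckeLength_iff {E : RankTwoBundle} {a b : ℤ} (φ : Iso E (splitBundle a b)) (k : ℕ) :
    HasHeckeLength E k ↔ |a - b| = k := by
  refine ⟨?_, fun h => ⟨a, b, ⟨φ⟩, h⟩⟩
  rintro ⟨c, d, ⟨χ⟩, h⟩
  rw [← h]
  exact abs_sub_eq_of_iso (φ.symm.trans χ)

/-! ### Surjectivity, terminal bundles and Hecke length. -/

namespace HeckeSequence

variable {n : ℕ} {p : Fin n → CP1}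

theorem exists_heckeMap_eq (hp : Function.Injective p) (hU : ∀ i, p i ∈ CP1.U 0)
    (a : Fin n → CP1) : ∃ s : HeckeSequence (splitBundle 0 0) p, heckeMap p s.toTot = a ∧
      ∃ c d : ℤ, c + d = -n ∧ s.terminal = splitBundle c d := by
  obtain ⟨s, ⟨c, d, hcd, hs⟩, h⟩ := exists_heckeSequence 0 0 p hp hU (fun i => (a i).rep)
    fun i => (a i).rep_nonzero
  refine ⟨s, (hasDirections_iff_heckeMap hp hU s a).1 ((hasDirections_iff hp hU s a).2
    fun i => ?_), c, d, by simpa using hcd, hs⟩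
  rw [h i, Projectivization.submodule_eq]

theorem exists_notMem_range (p : Fin n → CP1) : ∃ x ∈ CP1.U 0, x ∉ range p := by
  have h : Function.Injective (CP1.pt 0) := fun z w h => by
    rw [← CP1.ξ_pt 0 z, h, CP1.ξ_pt]
  by_contra! h1
  refine infinite_range_of_injective h ((finite_range p).subset ?_)
  rintro _ ⟨z, rfl⟩
  exact h1 _ (CP1.pt_mem_U 0 z)

/-- The terminal bundle of a sequence of Hecke modifications of `𝒪 ⊕ 𝒪` is split. -/
theorem exists_iso_terminal (hp : Function.Injective p) (hU : ∀ i, p i ∈ CP1.U 0)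
    (s : HeckeSequence (splitBundle 0 0) p) :
    ∃ c d : ℤ, c + d = -n ∧ c ≤ 0 ∧ d ≤ 0 ∧ Nonempty (Iso s.terminal (splitBundle c d)) := by
  -- A split model with the same directions is equivalent to `s` by injectivity of `h`, so its
  -- terminal bundle is isomorphic to that of `s`.
  obtain ⟨s', hs', c, d, hcd, ht⟩ := exists_heckeMap_eq hp hU (heckeMap p s.toTot)
  obtain ⟨φ⟩ := nonempty_iso_terminal (Quotient.exact (injective_heckeMap hp hU hs'.symm))
  rw [ht] at φ
  obtain ⟨x, hx, hxp⟩ := exists_notMem_range p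
  -- A generically injective morphism into `𝒪 ⊕ 𝒪` forces both degrees to be at most `0`.
  have h1 : Function.Injective (((s.compHom (Fin.last n)).comp φ.inv).toFun x) :=
    (s.bijective_compHom _ fun j _ h => hxp ⟨j, h.symm⟩).1.comp (φ.symm.bijective x).1
  have h2 := exists_le_of_injective _ hx h1
  simp only [Fin.forall_fin_two, Fin.exists_fin_two, Matrix.cons_val_zero,
    Matrix.cons_val_one, or_self] at h2
  exact ⟨c, d, hcd, h2.1, h2.2, ⟨φ⟩⟩

theorem affineHom_zero_apply {a b : ℤ} (A : Matrix (Fin 2) (Fin 2) ℂ) (hA) (hB) {x : CP1}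
    (hx : x ∈ CP1.U 0) (v : Fin 2 → ℂ) :
    ((affineHom 0 0 a b A 0 hA hB).toFun x v : Fin 2 → ℂ) = A.mulVec v := by
  change affineFamily 0 0 a b A 0 x v = _
  rw [affineFamily_apply, CP1.idx_eq_zero hx]
  congr 1
  ext k l
  simp [affineMatrix]

/-- A constant vector spanning the common line lifts through the whole sequence and gives a nonzero
morphism `𝒪 → 𝒪(c) ⊕ 𝒪(d)`, impossible if both degrees are negative. -/
theorem nonneg_of_heckeMap_eq (hp : Function.Injective p) (hU : ∀ i, p i ∈ CP1.U 0)
    (s : HeckeSequence (splitBundle 0 0) p) {c d : ℤ} (φ : Iso s.terminal (splitBundle c d))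
    {L : CP1} (hL : heckeMap p s.toTot = fun _ => L) : 0 ≤ c ∨ 0 ≤ d := by
  have hr := (hasDirections_iff hp hU s _).1 ((hasDirections_iff_heckeMap hp hU s _).2 hL)
  -- The constant section is encoded as the rank one endomorphism `v ↦ v 0 • L.rep`, so that source
  -- and target are both rank 2 bundles.
  let f : Hom (splitBundle 0 0) (splitBundle 0 0) :=
    affineHom 0 0 0 0 (Matrix.of fun k l => if l = 0 then L.rep k else 0) 0
      (fun k l _ => by fin_cases k <;> fin_cases l <;> simp) (fun k l h => absurd rfl h)
  have hf : ∀ x ∈ CP1.U 0, ∀ v : Fin 2 → ℂ, (f.toFun x v : Fin 2 → ℂ) = v 0 • L.rep := by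
    intro x hx v
    refine (affineHom_zero_apply _ _ _ hx v).trans ?_
    refine funext fun k : Fin 2 => ?_
    simp [Matrix.mulVec, dotProduct, mul_comm]
  obtain ⟨χ, hχ⟩ := s.exists_lift hp f (Fin.last n) fun j _ => by
    refine Subset.trans ?_ (hr j).symm.subset
    rintro _ ⟨v, rfl⟩
    rw [Projectivization.submodule_eq]
    exact (Submodule.mem_span_singleton (R := ℂ) (M := Fin 2 → ℂ)).2 ⟨_, (hf _ (hU j) v).symm⟩
  by_contra! hcd
  have hx := CP1.pt_mem_U 0 0
  let e : Fin 2 → ℂ := Pi.single 0 1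
  have h1 : splitCoords (φ.hom.comp χ) 0 (CP1.pt 0 0) e = 0 := by
    funext k
    refine splitCoords_eq_zero _ k 0 ?_ hx
    fin_cases k
    · exact hcd.1
    · exact hcd.2
  rw [splitCoords_zero_apply _ hx] at h1
  have h2 : χ.toFun (CP1.pt 0 0) e = 0 :=
    (φ.bijective (CP1.pt 0 0)).1 (h1.trans (map_zero (φ.hom.toFun (CP1.pt 0 0))).symm)
  have h3 : (f.toFun (CP1.pt 0 0) e : Fin 2 → ℂ) = 0 := by
    rw [← hχ]
    exact (congrArg ((s.compHom (Fin.last n)).toFun (CP1.pt 0 0)) h2).trans (map_zero _)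
  rw [hf _ hx] at h3
  have h4 : e 0 • L.rep = L.rep := by simp [e]
  exact L.rep_nonzero (h4.symm.trans h3)

/-- A summand of nonnegative degree has a section without zeros on `U 0`. Its image in `𝒪 ⊕ 𝒪` is a
constant vector by Liouville, nonzero by generic injectivity, and lies in the image at every `p i`;
so every line is its span. -/
theorem exists_heckeMap_eq_of_nonneg (hp : Function.Injective p) (hU : ∀ i, p i ∈ CP1.U 0)
    (s : HeckeSequence (splitBundle 0 0) p) {c d : ℤ} (φ : Iso s.terminal (splitBundle c d))
    (hcd : 0 ≤ c ∨ 0 ≤ d) : ∃ L, heckeMap p s.toTot = fun _ => L := by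
  have hr := (hasDirections_iff hp hU s _).1 ((hasDirections_iff_heckeMap hp hU s _).2 rfl)
  obtain ⟨g, hg⟩ : ∃ g : Hom (splitBundle 0 0) (splitBundle c d), ∀ x ∈ CP1.U 0,
      (g.toFun x (Pi.single 0 1 : Fin 2 → ℂ) : Fin 2 → ℂ) ≠ 0 := by
    obtain ⟨k₀, hk₀⟩ : ∃ k₀ : Fin 2, 0 ≤ (![c, d] : Fin 2 → ℤ) k₀ := by
      rcases hcd with h | h
      · exact ⟨0, h⟩
      · exact ⟨1, h⟩
    -- Row `k₀` is filled with ones: both source summands map to the summand of nonnegative degree.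
    -- Only the first is used.
    refine ⟨affineHom 0 0 c d (Matrix.of fun k l => if k = k₀ then 1 else 0) 0 (fun k l h => ?_)
      (fun k l h => absurd rfl h), fun x hx h => ?_⟩
    · have hk : k = k₀ := by
        by_contra hk
        exact h (by simp [hk])
      rw [hk]
      refine le_trans (le_of_eq ?_) hk₀
      fin_cases l <;> rfl
    · have h1 := congrFun ((affineHom_zero_apply _ _ _ hx _).symm.trans h) k₀
      simp only [Matrix.mulVec_single_one, Matrix.col_apply, Matrix.of_apply, if_true] at h1
      exact one_ne_zero h1
  let f : Hom (splitBundle 0 0) (splitBundle 0 0) :=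
    (s.compHom (Fin.last n)).comp (φ.inv.comp g)
  let e : Fin 2 → ℂ := Pi.single 0 1
  obtain ⟨w, hw⟩ : ∃ w : Fin 2 → ℂ, ∀ x ∈ CP1.U 0, (f.toFun x e : Fin 2 → ℂ) = w := by
    refine ⟨splitCoords f 0 (CP1.pt 0 0) e, fun x hx => ?_⟩
    rw [← splitCoords_zero_apply f hx]
    funext k
    have h : (![0, 0] : Fin 2 → ℤ) k ≤ (![0, 0] : Fin 2 → ℤ) 0 := by fin_cases k <;> simp
    exact (splitCoords_eq f k 0 h hx).trans (splitCoords_eq f k 0 h (CP1.pt_mem_U 0 0)).symm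
  have hw0 : w ≠ 0 := by
    obtain ⟨x, hx, hxp⟩ := exists_notMem_range p
    intro h
    have h1 := (hw x hx).trans h
    refine hg x hx ?_
    refine (φ.symm.bijective x).1 (Eq.trans ?_ (map_zero (φ.symm.hom.toFun x)).symm)
    refine (s.bijective_compHom (Fin.last n) fun j _ h => hxp ⟨j, h.symm⟩).1 ?_
    exact h1.trans (map_zero ((s.compHom (Fin.last n)).toFun x)).symm
  refine ⟨Projectivization.mk ℂ w hw0, funext fun i => ?_⟩
  have h1 : w ∈ (heckeMap p s.toTot i).submodule := by
    rw [← hw _ (hU i)]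
    refine (hr i).subset (s.range_compHom_subset (p i) (Fin.le_last i.succ) ?_)
    exact ⟨_, rfl⟩
  rw [Projectivization.submodule_eq, Submodule.mem_span_singleton] at h1
  obtain ⟨t, ht⟩ := h1
  rw [← (heckeMap p s.toTot i).mk_rep, Eq.comm, Projectivization.mk_eq_mk_iff']
  exact ⟨t, ht⟩

/-- Nonpositive `c, d` with sum `-n` and neither zero leave only `{-1, -1}` for `n = 2` and `{-1,
-2}` for `n = 3`; a zero degree gives length `n`. The bound `n ≤ 3` is essential: `{-1, -3}` is not
minimal for `n = 4`. -/
theorem hasHeckeLength_terminal_iff (hn : n ≤ 3) (hp : Function.Injective p)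
    (hU : ∀ i, p i ∈ CP1.U 0) (s : HeckeSequence (splitBundle 0 0) p) :
    HasHeckeLength s.terminal (n % 2) ↔ (2 ≤ n → ¬∃ L, heckeMap p s.toTot = fun _ => L) := by
  obtain ⟨c, d, hcd, hc, hd, ⟨φ⟩⟩ := s.exists_iso_terminal hp hU
  have h1 : (∃ L, heckeMap p s.toTot = fun _ => L) ↔ 0 ≤ c ∨ 0 ≤ d :=
    ⟨fun ⟨_, hL⟩ => s.nonneg_of_heckeMap_eq hp hU φ hL, s.exists_heckeMap_eq_of_nonneg hp hU φ⟩
  rw [hasHeckeLength_iff φ, h1]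
  rcases abs_cases (c - d) with h | h <;> omega

/-- `|c - d|` has the parity of `c + d = -n`. -/
theorem mod_two_le_of_hasHeckeLength (hp : Function.Injective p) (hU : ∀ i, p i ∈ CP1.U 0)
    (s : HeckeSequence (splitBundle 0 0) p) {k : ℕ} (hk : HasHeckeLength s.terminal k) :
    n % 2 ≤ k := by
  obtain ⟨c, d, hcd, -, -, ⟨φ⟩⟩ := s.exists_iso_terminal hp hU
  rw [hasHeckeLength_iff φ] at hk
  rcases abs_cases (c - d) with h | h <;> omega

theorem mem_heckeSpace_iff (hn : n ≤ 3) (hp : Function.Injective p) (hU : ∀ i, p i ∈ CP1.U 0)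
    (x : HeckeTot (splitBundle 0 0) p) :
    x ∈ HeckeSpace p ↔ (2 ≤ n → ¬∃ L, heckeMap p x = fun _ => L) := by
  constructor
  · rintro ⟨s, rfl, h⟩
    exact (hasHeckeLength_terminal_iff hn hp hU s).1 h
  · intro h
    induction x using Quotient.inductionOn with | _ s => ?_
    exact ⟨s, rfl, (hasHeckeLength_terminal_iff hn hp hU s).2 h⟩

theorem bijective_heckeMap (hp : Function.Injective p) (hU : ∀ i, p i ∈ CP1.U 0) :
    Function.Bijective (heckeMap p) :=
  ⟨injective_heckeMap hp hU, fun a =>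
    let ⟨s, hs, _⟩ := exists_heckeMap_eq hp hU a
    ⟨s.toTot, hs⟩⟩

theorem isLeast_heckeLength (hn : n ≤ 3) (hp : Function.Injective p)
    (hU : ∀ i, p i ∈ CP1.U 0) :
    IsLeast {k : ℕ | ∃ s : HeckeSequence (splitBundle 0 0) p, HasHeckeLength s.terminal k}
      (n % 2) := by
  refine ⟨?_, fun k ⟨s, hs⟩ => s.mod_two_le_of_hasHeckeLength hp hU hs⟩
  -- The directions `[1 : i]` are pairwise distinct, hence not all equal once `n ≥ 2`.
  obtain ⟨s, hs, -⟩ := exists_heckeMap_eq hp hU fun i => CP1.pt 0 (i : ℕ)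
  refine ⟨s, (hasHeckeLength_terminal_iff hn hp hU s).2 fun h2 => ?_⟩
  rintro ⟨L, hL⟩
  rw [hs] at hL
  have h3 := congrArg (CP1.ξ 0) ((congrFun hL ⟨0, by omega⟩).trans (congrFun hL ⟨1, by omega⟩).symm)
  simp [CP1.ξ_pt] at h3

theorem bijOn_heckeMap (hn : n ≤ 3) (hn2 : 2 ≤ n) (hp : Function.Injective p)
    (hU : ∀ i, p i ∈ CP1.U 0) :
    Set.BijOn (heckeMap p) (HeckeSpace p) {a | ∃ L, a = fun _ => L}ᶜ := by
  refine ⟨fun x hx => (mem_heckeSpace_iff hn hp hU x).1 hx hn2,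
    (injective_heckeMap hp hU).injOn, fun a ha => ?_⟩
  obtain ⟨x, rfl⟩ := (bijective_heckeMap hp hU).2 a
  exact ⟨x, (mem_heckeSpace_iff hn hp hU x).2 fun _ => ha, rfl⟩

end HeckeSequence

end

theorem mainTheorem10 :
    -- for `n ≤ 3` the map `h` is well-defined and bijective, and `n % 2` is the minimum
    -- possible Hecke length of the terminal bundle
    (∀ n : ℕ, n ≤ 3 → ∀ p : Fin n → CP1, Function.Injective p → (∀ i, p i ∈ CP1.U 0) →
      (∀ (s : HeckeSequence (splitBundle 0 0) p) (a : Fin n → CP1),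
        HasDirections s a ↔ heckeMap p s.toTot = a) ∧
      Function.Bijective (heckeMap p) ∧
      IsLeast {k : ℕ | ∃ s : HeckeSequence (splitBundle 0 0) p, HasHeckeLength s.terminal k}
        (n % 2)) ∧
    -- `ℋ(S², 0)` is a point
    (∀ p : Fin 0 → CP1, ∃ x, HeckeSpace p = {x}) ∧
    -- `ℋ(S², 1) = ℂP¹`
    (∀ p : Fin 1 → CP1, (∀ i, p i ∈ CP1.U 0) →
      Set.BijOn (fun x => heckeMap p x 0) (HeckeSpace p) Set.univ) ∧
    -- `ℋ(S², 2) = (ℂP¹)² - {(a, a)}`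
    (∀ p : Fin 2 → CP1, Function.Injective p → (∀ i, p i ∈ CP1.U 0) →
      Set.BijOn (heckeMap p) (HeckeSpace p) {a | ∃ b : CP1, a = ![b, b]}ᶜ) ∧
    -- `ℋ(S², 3) = (ℂP¹)³ - {(a, a, a)}`
    (∀ p : Fin 3 → CP1, Function.Injective p → (∀ i, p i ∈ CP1.U 0) →
      Set.BijOn (heckeMap p) (HeckeSpace p) {a | ∃ b : CP1, a = ![b, b, b]}ᶜ) := by
  refine ⟨fun n hn p hp hU => ⟨HeckeSequence.hasDirections_iff_heckeMap hp hU,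
    HeckeSequence.bijective_heckeMap hp hU, HeckeSequence.isLeast_heckeLength hn hp hU⟩,
    fun p => ?_, fun p hU => ?_, fun p hp hU => ?_, fun p hp hU => ?_⟩
  · have hp : Function.Injective p := Function.injective_of_subsingleton p
    have hU : ∀ i, p i ∈ CP1.U 0 := fun i => i.elim0
    -- `p` itself serves as the unique element of `(ℂP¹)⁰`.
    obtain ⟨x, -⟩ := (HeckeSequence.bijective_heckeMap hp hU).2 p
    refine ⟨x, Set.eq_singleton_iff_unique_mem.2 ⟨?_, fun y _ => ?_⟩⟩
    · exact (HeckeSequence.mem_heckeSpace_iff (by omega) hp hU x).2 fun h => absurd h (by omega)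
    · exact (HeckeSequence.bijective_heckeMap hp hU).1 (Subsingleton.elim _ _)
  · have hp : Function.Injective p := Function.injective_of_subsingleton p
    have hb := HeckeSequence.bijective_heckeMap hp hU
    refine ⟨fun _ _ => mem_univ _, fun x _ y _ h => hb.1 (funext fun i => ?_), fun a _ => ?_⟩
    · rw [Subsingleton.elim i 0]
      exact h
    · obtain ⟨x, hx⟩ := hb.2 fun _ => a
      exact ⟨x, (HeckeSequence.mem_heckeSpace_iff (by omega) hp hU x).2 fun h =>
        absurd h (by omega), congrFun hx 0⟩
  · have h : ∀ b : CP1, ![b, b] = fun _ => b := fun b => by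
      ext i
      fin_cases i <;> rfl
    simp only [h]
    exact HeckeSequence.bijOn_heckeMap (by omega) le_rfl hp hU
  · have h : ∀ b : CP1, ![b, b, b] = fun _ => b := fun b => by
      ext i
      fin_cases i <;> rfl
    simp only [h]
    exact HeckeSequence.bijOn_heckeMap le_rfl (by omega) hp hU
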